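/- Let $G=(\Lambda,E)$ be a finite graph with edge weights $\beta_{kl}=\beta_{lk}>0$ for $kl\in E$ and $\beta_{kl}=0$ for $kl\notin E$. **The $\mathbb{H}^2$ model.** Let $\mathbb{H}^2=\{u=(x,y,z)\in\mathbb{R}^3: x^2+y^2-z^2=-1,\ z>0\}$, with $u\cdot u'=xx'+yy'-zz'$ and with invariant measure $du=\frac{dx\,dy}{z}$ in the coordinates $(x,y)\in\mathbb{R}^2$, $z=\sqrt{1+x^2+y^2}$. For $u=(u_k)_{k\in\Lambda}\in(\mathbb{H}^2)^\Lambda$ let $$H_{\beta,0}(u)=\tfrac12\sum_{kl\in E}\beta_{kl}\,(u_k-u_l)\cdot(u_k-u_l),\qquad \langle \Phi\rangle_{\beta,0}=\int_{(\mathbb{H}^2)^\Lambda}\Phi(u)\,e^{-H_{\beta,0}(u)}\prod_{k\in\Lambda}du_k .$$ This expectation is unnormalised, because the total mass is infinite without an external field. **The VRJP.** For $i\in\Lambda$ and $\ell\in(0,\infty)^\Lambda$, the vertex-reinforced jump process with initial vertex $i$ and initial local times $\ell$ is the continuous-time jump process $(X_t)_{t\ge0}$ on $\Lambda$ with $X_0=i$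 which, given its past up to time $t$ and $X_t=k$, jumps from $k$ to $l$ at rate $\beta_{kl}L^l_t$, where $L^l_t=\ell_l+\int_0^t 1_{X_s=l}\,ds$. Let $\mathbb{E}^{\mathrm{VRJP}(\beta,\ell)}_i$ be its expectation and $L_t=(L_t^l)_{l\in\Lambda}$. **Theorem.** Let $i,j\in\Lambda$, and let $F\colon\mathbb{R}^\Lambda\to\mathbb{R}$ be measurable and decay fast enough that $\langle |x_ix_jF(z)|\rangle_{\beta,0}<\infty$, where $z=(z_k)_{k\in\Lambda}$. Then $$\langle x_ix_jF(z)\rangle_{\beta,0}=\Big\langle z_i\int_0^\infty \mathbb{E}^{\mathrm{VRJP}(\beta,z)}_i\big[F(L_t)1_{X_t=j}\big]\,dt\Big\rangle_{\beta,0},$$ where the right-hand side is well defined: for almost every $u$, the expectation converges absolutely for almost every $t>0$ and is integrable in $t$ over $(0,\infty)$; and $z_i$ times the integral over $t$ is absolutely integrable with respect to $e^{-H_{\beta,0}(u)}\prod_k du_k$. -/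

import Mathlib

open MeasureTheory ProbabilityTheory
open scoped ENNReal NNReal

noncomputable section

/-! ## The hyperbolic plane and the `ℍ²` spin model -/

namespace H2Model

/-- The Minkowski inner product `x x' + y y' - z z'` on `ℝ³`, with `u = (x, y, z)`. -/
def mink (u v : ℝ × ℝ × ℝ) : ℝ := u.1 * v.1 + u.2.1 * v.2.1 - u.2.2 * v.2.2

/-- The hyperbolic plane `ℍ² = {u : u · u = -1, z > 0}`. -/
def hyperboloid : Set (ℝ × ℝ × ℝ) := {u | mink u u = -1 ∧ 0 < u.2.2}

/-- The height `z = √(1 + x² + y²)` of the point of `ℍ²` over `(x, y)`. -/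
def zCoord (p : ℝ × ℝ) : ℝ := Real.sqrt (1 + p.1 ^ 2 + p.2 ^ 2)

/-- The parametrisation of `ℍ²` by `(x, y) ∈ ℝ²`. -/
def spin (p : ℝ × ℝ) : ℝ × ℝ × ℝ := (p.1, p.2, zCoord p)

/-- `spin` is a bijection from `ℝ²` onto `ℍ²`. -/
theorem spin_bijOn : Set.BijOn spin Set.univ hyperboloid := by
  refine ⟨fun p _ => ⟨?_, ?_⟩, fun p _ q _ h => ?_, fun u hu => ?_⟩
  · have h := Real.sq_sqrt (show (0 : ℝ) ≤ 1 + p.1 ^ 2 + p.2 ^ 2 by positivity)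
    simp only [mink, spin, zCoord]
    nlinarith
  · simp only [spin, zCoord]
    positivity
  · simp only [spin, Prod.mk.injEq] at h
    exact Prod.ext h.1 h.2.1
  · obtain ⟨h1, h2⟩ := hu
    refine ⟨(u.1, u.2.1), trivial, ?_⟩
    have : zCoord (u.1, u.2.1) = u.2.2 := by
      simp only [mink] at h1
      rw [zCoord, Real.sqrt_eq_iff_mul_self_eq (by positivity) h2.le]
      simp only
      linarith
    simp [spin, this]

variable {V : Type*} [Fintype V]

/-- The field of heights `z = (z_i)` of a spin configuration, in the coordinates `(x_i, y_i)`. -/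
def zField (p : V → ℝ × ℝ) : V → ℝ := fun i => zCoord (p i)

/-- The action `H_{β,h}(u) = ½ ∑_{ij ∈ E} β_{ij} (u_i - u_j) · (u_i - u_j) + h ∑_i z_i`.
The sum over all ordered pairs counts each edge twice, whence the second factor `1 / 2`. -/
def action (β : V → V → ℝ) (h : ℝ) (p : V → ℝ × ℝ) : ℝ :=
  (1 / 2) * ((1 / 2) * ∑ i, ∑ j,
    β i j * mink (spin (p i) - spin (p j)) (spin (p i) - spin (p j))) + h * ∑ i, zCoord (p i)

/-- The (unnormalised) measure `∏_i du_i e^{-H_{β,h}(u)}` of the `ℍ²` model, where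
`du = dx dy / z` is the invariant measure of `ℍ²`, in the coordinates `(x_i, y_i)`. -/
def gibbs (β : V → V → ℝ) (h : ℝ) : Measure (V → ℝ × ℝ) :=
  volume.withDensity fun p =>
    ENNReal.ofReal ((∏ i, (zCoord (p i))⁻¹) * Real.exp (-action β h p))

/-- The (unnormalised) expectation `⟨Φ⟩_{β,h}` of the `ℍ²` model. -/
def expect (β : V → V → ℝ) (h : ℝ) (Φ : (V → ℝ × ℝ) → ℝ) : ℝ := ∫ p, Φ p ∂(gibbs β h)

end H2Model

/-! ## The vertex-reinforced jump process -/

namespace VRJP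

set_option linter.unusedSectionVars false

variable {V : Type*} [Fintype V] [DecidableEq V]

/-- The joint state of the walk and of its local times. -/
abbrev State (V : Type*) := V × (V → ℝ)

/-- The rate `β_{ij} ℓ_j` of a jump to `j` in the state `(i, ℓ)`. -/
def jumpRate (β : V → V → ℝ) (s : State V) (j : V) : ℝ≥0 := (β s.1 j * s.2 j).toNNReal

/-- The total rate `∑_j β_{ij} ℓ_j` in the state `(i, ℓ)`. -/
def totalRate (β : V → V → ℝ) (s : State V) : ℝ≥0 := ∑ j, jumpRate β s j

/-- The rate of the exponential waiting time in the state `s`. A walk with total rate `0` never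
leaves its vertex; it is made to perform invisible jumps from the vertex to itself, at rate `1`. -/
def clockRate (β : V → V → ℝ) (s : State V) : ℝ≥0 :=
  if totalRate β s = 0 then 1 else totalRate β s

/-- The probability that the jump out of the state `s` leads to the vertex `j`. -/
def jumpProb (β : V → V → ℝ) (s : State V) (j : V) : ℝ≥0 :=
  if totalRate β s = 0 then (if j = s.1 then 1 else 0) else jumpRate β s j / totalRate β s

/-- The state after a stay of duration `τ` in the state `s` and a jump to `j`. -/
def afterStay (s : State V) (j : V) (τ : ℝ) : State V :=
  (j, Function.update s.2 s.1 (s.2 s.1 + τ))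

variable [MeasurableSpace V] [DiscreteMeasurableSpace V]

/-- The law of the state right after the next jump: the waiting time is exponential of rate
`clockRate β s`, and independent of it the target has the weights `jumpProb β s`. (The rates
`β_{ij} ℓ_j`, `j ≠ i`, do not change during a stay at `i`, since only `ℓ_i` grows.) -/
def stepMeasure (β : V → V → ℝ) (s : State V) : Measure (State V) :=
  ∑ j, jumpProb β s j • (expMeasure (clockRate β s)).map (afterStay s j)

theorem clockRate_pos (β : V → V → ℝ) (s : State V) : 0 < clockRate β s := by
  unfold clockRate
  split_ifs with h
  · exact one_pos
  · exact pos_iff_ne_zero.mpr h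

theorem sum_jumpProb (β : V → V → ℝ) (s : State V) : ∑ j, jumpProb β s j = 1 := by
  unfold jumpProb
  split_ifs with h
  · simp
  · rw [← Finset.sum_div]
    exact div_self h

theorem measurable_afterStay :
    Measurable fun q : (State V × V) × ℝ => afterStay q.1.1 q.1.2 q.2 := by
  refine Measurable.prodMk (by fun_prop) (measurable_pi_iff.mpr fun v => ?_)
  have h1 : Measurable fun q : (State V × V) × ℝ => q.1.1.2 v := by fun_prop
  have h2 : MeasurableSet {q : (State V × V) × ℝ | v = q.1.1.1} :=
    (MeasurableSet.of_discrete (s := {w : V | v = w})).preimage (by fun_prop)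
  have h3 : (fun q : (State V × V) × ℝ => (afterStay q.1.1 q.1.2 q.2).2 v)
      = fun q => if v = q.1.1.1 then q.1.1.2 v + q.2 else q.1.1.2 v := by
    funext q
    simp only [afterStay, Function.update_apply]
    split_ifs with h
    · rw [h]
    · rfl
  change Measurable fun q : (State V × V) × ℝ => (afterStay q.1.1 q.1.2 q.2).2 v
  rw [h3]
  exact Measurable.ite h2 (h1.add measurable_snd) h1

theorem measurable_jumpRate (β : V → V → ℝ) (j : V) :
    Measurable fun s : State V => jumpRate β s j := by
  unfold jumpRate
  have : Measurable fun s : State V => β s.1 j :=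
    (Measurable.of_discrete (f := fun i => β i j)).comp measurable_fst
  fun_prop

theorem measurable_totalRate (β : V → V → ℝ) :
    Measurable fun s : State V => totalRate β s :=
  Finset.measurable_fun_sum _ fun j _ => measurable_jumpRate β j

theorem measurable_clockRate (β : V → V → ℝ) :
    Measurable fun s : State V => clockRate β s :=
  Measurable.ite (measurable_totalRate β (measurableSet_singleton 0)) measurable_const
    (measurable_totalRate β)

theorem measurable_jumpProb (β : V → V → ℝ) (j : V) :
    Measurable fun s : State V => jumpProb β s j := by
  refine Measurable.ite (measurable_totalRate β (measurableSet_singleton 0)) ?_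
    ((measurable_jumpRate β j).div (measurable_totalRate β))
  exact (Measurable.of_discrete (f := fun i : V => if j = i then (1 : ℝ≥0) else 0)).comp
    measurable_fst

theorem measurable_stepMeasure (β : V → V → ℝ) : Measurable (stepMeasure β) := by
  refine Measure.measurable_of_measurable_coe _ fun A hA => ?_
  have hA' (j : V) : MeasurableSet {q : State V × ℝ | afterStay q.1 j q.2 ∈ A} :=
    (measurable_afterStay.comp
      (by fun_prop : Measurable fun q : State V × ℝ => ((q.1, j), q.2))) hA
  have hs (s : State V) (j : V) : Measurable (afterStay s j) :=
    measurable_afterStay.comp (by fun_prop : Measurable fun τ : ℝ => ((s, j), τ))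
  have key (s : State V) : stepMeasure β s A = ∑ j, (jumpProb β s j : ℝ≥0∞) *
      ∫⁻ τ : ℝ, (if 0 ≤ τ then ENNReal.ofReal (clockRate β s * Real.exp (-(clockRate β s * τ)))
        else 0) * {q : State V × ℝ | afterStay q.1 j q.2 ∈ A}.indicator 1 (s, τ) := by
    simp only [stepMeasure, Measure.coe_finsetSum, Finset.sum_apply, Measure.smul_apply]
    refine Finset.sum_congr rfl fun j _ => ?_
    rw [ENNReal.smul_def, smul_eq_mul, Measure.map_apply (hs s j) hA, expMeasure, gammaMeasure,
      withDensity_apply _ (hs s j hA), ← lintegral_indicator (hs s j hA)]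
    congr 1
    refine lintegral_congr fun τ => ?_
    have : gammaPDF 1 (clockRate β s) τ = exponentialPDF (clockRate β s) τ := rfl
    by_cases h : afterStay s j τ ∈ A
    · simp [Set.indicator, h, this, exponentialPDF_eq, apply_ite ENNReal.ofReal]
    · simp [Set.indicator, h]
  simp only [key]
  refine Finset.measurable_fun_sum _ fun j _ =>
    (measurable_jumpProb β j).coe_nnreal_ennreal.mul ?_
  refine Measurable.lintegral_prod_right' (f := fun q : State V × ℝ =>
    (if 0 ≤ q.2 then ENNReal.ofReal (clockRate β q.1 * Real.exp (-(clockRate β q.1 * q.2)))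
      else 0) * {q : State V × ℝ | afterStay q.1 j q.2 ∈ A}.indicator 1 q) ?_
  refine Measurable.mul (Measurable.ite (measurableSet_le measurable_const measurable_snd) ?_
    measurable_const) (measurable_one.indicator (hA' j))
  have := (measurable_clockRate β).comp (measurable_fst : Measurable (Prod.fst : State V × ℝ → _))
  have h2 : Measurable fun q : State V × ℝ => (clockRate β q.1 : ℝ) := this.coe_nnreal_real
  fun_prop

/-- The transition kernel of the Markov chain of the successive states right after jumps. -/
def stepKernel (β : V → V → ℝ) : Kernel (State V) (State V) :=
  ⟨stepMeasure β, measurable_stepMeasure β⟩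

instance (β : V → V → ℝ) : IsMarkovKernel (stepKernel β) := by
  refine ⟨fun s => ⟨?_⟩⟩
  have hs (j : V) : Measurable (afterStay s j) :=
    measurable_afterStay.comp (by fun_prop : Measurable fun τ : ℝ => ((s, j), τ))
  have := isProbabilityMeasure_expMeasure (r := clockRate β s) (by exact_mod_cast clockRate_pos β s)
  change stepMeasure β s Set.univ = 1
  simp only [stepMeasure, Measure.coe_finsetSum, Finset.sum_apply, Measure.smul_apply]
  have h (j : V) : (expMeasure (clockRate β s)).map (afterStay s j) Set.univ = 1 := by
    rw [Measure.map_apply (hs j) MeasurableSet.univ, Set.preimage_univ, measure_univ]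
  simp only [h, ENNReal.smul_def, smul_eq_mul, mul_one]
  exact_mod_cast sum_jumpProb β s

/-- The probability space of the VRJP: `ω n` is the state (vertex, local times) right after the
`n`-th jump, and `ω 0` is the initial state. -/
abbrev Path (V : Type*) := ℕ → State V

/-- The law `P^{VRJP(β,ℓ)}_i` of the jump chain with initial vertex `i` and initial local
times `ℓ`: the Markov chain with transition kernel `stepKernel β` started from `(i, ℓ)`. -/
def law (β : V → V → ℝ) (i : V) (ℓ : V → ℝ) : Measure (Path V) :=
  Kernel.traj (X := fun _ => State V)
    (fun n => (stepKernel β).comap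
      (fun h : (k : Finset.Iic n) → State V => h ⟨n, Finset.mem_Iic.mpr le_rfl⟩)
      (measurable_pi_apply _))
    0 (fun _ => (i, ℓ))

/-- The time of the `n`-th jump: the total local time accrued until then. -/
def jumpTime (ω : Path V) (n : ℕ) : ℝ := ∑ v, ((ω n).2 v - (ω 0).2 v)

/-- The position `X_t` of the walk at time `t`: the vertex occupied after `n` jumps, for the
first `n` such that the `(n + 1)`-st jump happens after time `t`. -/
def pos (ω : Path V) (t : ℝ) : V := (ω (sInf {n : ℕ | t < jumpTime ω (n + 1)})).1

/-- The local time `L^v_t = ℓ_v + ∫_0^t 1_{X_s = v} ds` at the vertex `v` at time `t`. -/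
def localTime (ω : Path V) (t : ℝ) : V → ℝ :=
  fun v => (ω 0).2 v + ∫ s in (0 : ℝ)..t, if pos ω s = v then (1 : ℝ) else 0

end VRJP

end

/-!
The identity is a Ward identity for the Lorentz boosts `T_j = z_j ∂_{x_j}` of single spins,
iterated along the jumps of the walk.

The boost `T_j` preserves the measure `dx dy / z` and satisfies `T_j z_j = x_j`. For a function
`g (j, ℓ)` of a vertex and of local times, let `φ = stay β g`, the expected integral of `g` along
a stay, which solves `(c_j - ∂_j) φ (j, ·) = g (j, ·)` where `c_j` is the rate of leaving `j`.
Integrating `T_j (x_i φ (j, z) e^{-H})` gives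
`⟨x_i x_j g (j, z)⟩ = 1_{i = j} ⟨z_i φ (i, z)⟩ + ⟨x_i φ (j, z) z_j ∑_l β_{jl} x_l⟩`
(`H2Model.integral_wardIntegrand`). Since `β` is symmetric, summing over `j` yields
`N (g) = ⟨z_i φ (i, z)⟩ + N (Q φ)`, where `N (f) = ⟨x_i ∑_j x_j f (j, z)⟩` and `Q = jumpOp β` has
the kernel `β_{jl} ℓ_l` (`H2Model.spinForm_eq_add`). At a vertex without neighbours the clock rate
exceeds the sum of the jump rates by `1`; this gives a further term `⟨x_i x_j φ (j, z)⟩` in the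
Ward identity, which is the contribution to `N (Q φ)` of the invisible jumps.

Iterating, `N (g)` is the sum over `n` of `⟨z_i (stay (Q stay)^n g) (i, z)⟩`, plus a remainder. For
`g` bounded and supported on total local time at most `K`, the remainder after `n` steps is of the
order of `(C K)^n / n!` (`VRJP.EnvelopeBound.iterate`). As one step of the jump chain is the
operator `stay Q`, the summand is the expectation of the integral of `g` along the stay after the
`n`-th jump, so the series, `VRJP.potential`, is the expected occupation integral of `g`
(`VRJP.lintegral_lintegral_stateAt`). The same factorial bounds show that the walk does not
explode.

No smoothness of the semigroup of the walk, or of `F`, is needed: for measurable `g` the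
integration by parts in the one variable `x_j` is an interchange of integrals
(`H2Model.integral_deriv_mul_tail_sub`). Truncation and monotone convergence then give the identity
for all nonnegative `F` with `⟨|x_i x_j F(z)|⟩ < ∞`, and signed `F` are split into their two parts.
-/

namespace VRJP

variable {V : Type*} [Fintype V] [DecidableEq V]

/-! ### The stay and jump operators -/

/-- The occupation functional of a single stay: the expected integral of `g` along the states
visited during a stay at `s.1` that starts in the state `s` and ends at rate `clockRate β s`. -/
noncomputable def stay (β : V → V → ℝ) (g : State V → ℝ≥0∞) (s : State V) : ℝ≥0∞ :=
  ∫⁻ τ in Set.Ioi (0 : ℝ),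
    ENNReal.ofReal (Real.exp (-(clockRate β s * τ))) * g (afterStay s s.1 τ)

/-- The jump part of the generator: the sum of the values of `g` after a jump out of `s`, each
weighted with the rate of that jump (invisible jumps included). -/
noncomputable def jumpOp (β : V → V → ℝ) (g : State V → ℝ≥0∞) (s : State V) : ℝ≥0∞ :=
  ∑ l, ((clockRate β s * jumpProb β s l : ℝ≥0) : ℝ≥0∞) * g (l, s.2)

theorem totalRate_afterStay {β : V → V → ℝ} (hβ : ∀ k, β k k = 0) (s : State V) (τ : ℝ) :
    totalRate β (afterStay s s.1 τ) = totalRate β s := by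
  unfold totalRate
  refine Finset.sum_congr rfl fun l _ => ?_
  by_cases h : l = s.1
  · simp [jumpRate, afterStay, h, hβ]
  · simp [jumpRate, afterStay, h]

theorem clockRate_afterStay {β : V → V → ℝ} (hβ : ∀ k, β k k = 0) (s : State V) (τ : ℝ) :
    clockRate β (afterStay s s.1 τ) = clockRate β s := by
  simp only [clockRate, totalRate_afterStay hβ]

theorem jumpProb_afterStay {β : V → V → ℝ} (hβ : ∀ k, β k k = 0) (s : State V) (τ : ℝ) (l : V) :
    jumpProb β (afterStay s s.1 τ) l = jumpProb β s l := by
  have h1 : jumpRate β (afterStay s s.1 τ) l = jumpRate β s l := by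
    by_cases h : l = s.1
    · simp [jumpRate, afterStay, h, hβ]
    · simp [jumpRate, afterStay, h]
  simp only [jumpProb, totalRate_afterStay hβ, h1]
  rfl

theorem sum_afterStay (s : State V) (j : V) (τ : ℝ) :
    ∑ v, (afterStay s j τ).2 v = ∑ v, s.2 v + τ := by
  have h : (afterStay s j τ).2 = s.2 + Pi.single s.1 τ := by
    funext v
    by_cases h : v = s.1
    · subst h; simp [afterStay]
    · simp [afterStay, h]
  simp [h, Finset.sum_add_distrib]

variable [MeasurableSpace V] [DiscreteMeasurableSpace V]

theorem measurable_afterStay_self :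
    Measurable fun q : State V × ℝ => afterStay q.1 q.1.1 q.2 :=
  measurable_afterStay.comp (by fun_prop : Measurable fun q : State V × ℝ => ((q.1, q.1.1), q.2))

theorem measurable_afterStay_right (s : State V) (j : V) : Measurable (afterStay s j) :=
  measurable_afterStay.comp (by fun_prop : Measurable fun τ : ℝ => ((s, j), τ))

theorem measurable_clockRate_real (β : V → V → ℝ) :
    Measurable fun s : State V => (clockRate β s : ℝ) :=
  (measurable_clockRate β).coe_nnreal_real

theorem measurable_stay (β : V → V → ℝ) {g : State V → ℝ≥0∞} (hg : Measurable g) :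
    Measurable (stay β g) := by
  refine Measurable.lintegral_prod_right' (f := fun q : State V × ℝ =>
    ENNReal.ofReal (Real.exp (-(clockRate β q.1 * q.2))) * g (afterStay q.1 q.1.1 q.2)) ?_
  have h1 : Measurable fun q : State V × ℝ => (clockRate β q.1 : ℝ) :=
    (measurable_clockRate_real β).comp measurable_fst
  have h2 := hg.comp (measurable_afterStay_self (V := V))
  exact (by fun_prop : Measurable fun q : State V × ℝ =>
    ENNReal.ofReal (Real.exp (-(clockRate β q.1 * q.2)))).mul h2

theorem measurable_jumpOp (β : V → V → ℝ) {g : State V → ℝ≥0∞} (hg : Measurable g) :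
    Measurable (jumpOp β g) :=
  Finset.measurable_fun_sum _ fun l _ =>
    ((measurable_clockRate β).mul (measurable_jumpProb β l)).coe_nnreal_ennreal.mul
      (hg.comp (by fun_prop : Measurable fun s : State V => (l, s.2)))

theorem lintegral_expMeasure (c : ℝ) {f : ℝ → ℝ≥0∞} (hf : Measurable f) :
    ∫⁻ τ, f τ ∂(expMeasure c) =
      ∫⁻ τ in Set.Ioi (0 : ℝ), ENNReal.ofReal (c * Real.exp (-(c * τ))) * f τ := by
  have h0 : expMeasure c = volume.withDensity (exponentialPDF c) := rfl
  have hm : Measurable (exponentialPDF c) := (measurable_exponentialPDFReal c).ennreal_ofReal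
  rw [h0, lintegral_withDensity_eq_lintegral_mul _ hm hf, ← setLIntegral_univ,
    ← Set.Iic_union_Ioi (a := (0 : ℝ)), lintegral_union (A := Set.Iic (0 : ℝ))
    measurableSet_Ioi (Set.Iic_disjoint_Ioi le_rfl),
    setLIntegral_congr Iio_ae_eq_Iic.symm]
  rw [setLIntegral_congr_fun (g := fun _ => 0) measurableSet_Iio
    (fun x hx => by simp [exponentialPDF_of_neg hx])]
  rw [lintegral_zero, zero_add]
  refine setLIntegral_congr_fun measurableSet_Ioi fun x hx => ?_
  simp [exponentialPDF_of_nonneg (le_of_lt hx)]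

/-- The integral against one step of the jump chain, as a sum over the target vertices of an
integral over the waiting time. -/
theorem lintegral_stepKernel (β : V → V → ℝ) (s : State V) {f : State V → ℝ≥0∞}
    (hf : Measurable f) :
    ∫⁻ s', f s' ∂(stepKernel β s) = ∑ l, (jumpProb β s l : ℝ≥0∞) *
      ∫⁻ τ in Set.Ioi (0 : ℝ), ENNReal.ofReal (clockRate β s * Real.exp (-(clockRate β s * τ))) *
        f (afterStay s l τ) := by
  change ∫⁻ s', f s' ∂(∑ j, jumpProb β s j • (expMeasure (clockRate β s)).map (afterStay s j)) = _
  rw [lintegral_finsetSum_measure]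
  refine Finset.sum_congr rfl fun l _ => ?_
  rw [lintegral_smul_measure, lintegral_map hf (measurable_afterStay_right s l),
    lintegral_expMeasure _ (f := fun τ => f (afterStay s l τ))
      (hf.comp (measurable_afterStay_right s l))]
  rfl

/-- One step of the jump chain is a stay followed by a jump: the rates out of `s` do not change
during the stay, because `β` vanishes on the diagonal. -/
theorem lintegral_stepKernel_eq_stay_jumpOp {β : V → V → ℝ} (hβ : ∀ k, β k k = 0) (s : State V)
    {f : State V → ℝ≥0∞} (hf : Measurable f) :
    ∫⁻ s', f s' ∂(stepKernel β s) = stay β (jumpOp β f) s := by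
  rw [lintegral_stepKernel β s hf]
  unfold stay jumpOp
  simp_rw [Finset.mul_sum, clockRate_afterStay hβ, jumpProb_afterStay hβ]
  have hf' (l : V) : Measurable fun τ : ℝ => f (afterStay s l τ) :=
    hf.comp (measurable_afterStay_right s l)
  have he (l : V) (τ : ℝ) : (l, (afterStay s s.1 τ).2) = afterStay s l τ := rfl
  simp_rw [he]
  have hm (l : V) : Measurable fun τ : ℝ => ENNReal.ofReal (Real.exp (-(clockRate β s * τ))) *
      (((clockRate β s * jumpProb β s l : ℝ≥0) : ℝ≥0∞) * f (afterStay s l τ)) :=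
    Measurable.mul (by fun_prop) ((hf' l).const_mul _)
  rw [lintegral_finsetSum _ (fun l _ => hm l)]
  refine Finset.sum_congr rfl fun l _ => ?_
  rw [← lintegral_const_mul' _ _ ENNReal.coe_ne_top]
  refine lintegral_congr fun τ => ?_
  rw [ENNReal.ofReal_mul (by positivity), ENNReal.coe_mul, ENNReal.ofReal_coe_nnreal]
  ring

theorem expMeasure_Ioi {c : ℝ} (hc : 0 < c) {x : ℝ} (hx : 0 ≤ x) :
    expMeasure c (Set.Ioi x) = ENNReal.ofReal (Real.exp (-(c * x))) := by
  have := isProbabilityMeasure_expMeasure hc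
  have h := cdf_expMeasure_eq hc x
  rw [if_pos hx, cdf_eq_real] at h
  rw [← Set.compl_Iic, ← ofReal_measureReal, probReal_compl_eq_one_sub measurableSet_Iic, h]
  congr 1; ring

/-- The expected integral of `g` along a stay, computed from the state after the next jump. -/
theorem lintegral_stepKernel_stay (β : V → V → ℝ) (s : State V) {g : State V → ℝ≥0∞}
    (hg : Measurable g) :
    ∫⁻ s', (∫⁻ τ in Set.Ioo (0 : ℝ) (∑ v, s'.2 v - ∑ v, s.2 v), g (afterStay s s.1 τ))
      ∂(stepKernel β s) = stay β g s := by
  have hc : (0 : ℝ) < clockRate β s := by exact_mod_cast clockRate_pos β s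
  have hg' : Measurable fun τ : ℝ => g (afterStay s s.1 τ) :=
    hg.comp (measurable_afterStay_right s s.1)
  have hset (a : ℝ) : ∫⁻ τ in Set.Ioo (0 : ℝ) a, g (afterStay s s.1 τ)
      = ∫⁻ τ in Set.Ioi (0 : ℝ), {q : ℝ × ℝ | q.2 < q.1}.indicator
        (fun q => g (afterStay s s.1 q.2)) (a, τ) := by
    rw [← Set.Ioi_inter_Iio, Set.inter_comm, ← Measure.restrict_restrict measurableSet_Iio,
      ← lintegral_indicator measurableSet_Iio]
    rfl
  have hm : Measurable ({q : ℝ × ℝ | q.2 < q.1}.indicator fun q => g (afterStay s s.1 q.2)) :=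
    (hg'.comp measurable_snd).indicator (measurableSet_lt measurable_snd measurable_fst)
  have hm1 : Measurable fun a : ℝ => ∫⁻ τ in Set.Ioo (0 : ℝ) a, g (afterStay s s.1 τ) := by
    simp_rw [hset]
    exact hm.lintegral_prod_right'
  have hsum : Measurable fun s' : State V => ∑ v, s'.2 v - ∑ v, s.2 v := by fun_prop
  rw [lintegral_stepKernel β s (f := fun s' : State V =>
    ∫⁻ τ in Set.Ioo (0 : ℝ) (∑ v, s'.2 v - ∑ v, s.2 v), g (afterStay s s.1 τ)) (hm1.comp hsum)]
  simp_rw [sum_afterStay, add_sub_cancel_left]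
  rw [← Finset.sum_mul]
  have h1 : ∑ l, (jumpProb β s l : ℝ≥0∞) = 1 := by exact_mod_cast sum_jumpProb β s
  rw [h1, one_mul, ← lintegral_expMeasure _ hm1]
  simp_rw [hset]
  have := isProbabilityMeasure_expMeasure hc
  rw [lintegral_lintegral_swap (f := fun a τ => {q : ℝ × ℝ | q.2 < q.1}.indicator
    (fun q => g (afterStay s s.1 q.2)) (a, τ)) hm.aemeasurable]
  -- The stay is longer than `τ` with probability `exp (-(c τ))`.
  refine setLIntegral_congr_fun measurableSet_Ioi fun τ hτ => ?_
  have h2 (a : ℝ) : {q : ℝ × ℝ | q.2 < q.1}.indicator (fun q => g (afterStay s s.1 q.2)) (a, τ)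
      = (Set.Ioi τ).indicator (fun _ => g (afterStay s s.1 τ)) a := rfl
  simp_rw [h2]
  rw [lintegral_indicator_const measurableSet_Ioi, expMeasure_Ioi hc (le_of_lt hτ), mul_comm]

end VRJP

namespace VRJP

set_option linter.unusedSectionVars false

variable {V : Type*} [Fintype V] [DecidableEq V]

/-! ### Factorial bounds under a cap on the total local time -/

/-- The function `(K - ∑ ℓ) ^ n / n!` of the local times `ℓ`, cut off to `{∑ ℓ ≤ K}`. For `n = 0`
it is the indicator of this set. -/
noncomputable def envelope (K : ℝ) (n : ℕ) (s : State V) : ℝ≥0∞ :=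
  if ∑ v, s.2 v ≤ K then ENNReal.ofReal ((K - ∑ v, s.2 v) ^ n / n.factorial) else 0

/-- A bound on the clock rate in the states with nonnegative local times of sum at most `K`. -/
noncomputable def rateBound (β : V → V → ℝ) (K : ℝ) : ℝ≥0 :=
  1 + ∑ k, ∑ l, (β k l).toNNReal * K.toNNReal

theorem clockRate_le_rateBound (β : V → V → ℝ) {K : ℝ} {s : State V} (hs : ∀ v, 0 ≤ s.2 v)
    (hK : ∑ v, s.2 v ≤ K) : clockRate β s ≤ rateBound β K := by
  have h1 : totalRate β s ≤ ∑ k, ∑ l, (β k l).toNNReal * K.toNNReal := by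
    refine le_trans (Finset.sum_le_sum fun l _ => ?_)
      (Finset.single_le_sum (f := fun k => ∑ l, (β k l).toNNReal * K.toNNReal)
        (fun _ _ => by positivity) (Finset.mem_univ s.1))
    have h2 : s.2 l ≤ K :=
      (Finset.single_le_sum (fun v _ => hs v) (Finset.mem_univ l)).trans hK
    unfold jumpRate
    rw [mul_comm, Real.toNNReal_mul (hs l), mul_comm]
    gcongr
  unfold clockRate rateBound
  split_ifs
  · exact le_self_add
  · exact h1.trans le_add_self

theorem envelope_le (K : ℝ) (n : ℕ) {s : State V} (hs : ∀ v, 0 ≤ s.2 v) :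
    envelope K n s ≤ ENNReal.ofReal (K ^ n / n.factorial) := by
  unfold envelope
  have h0 : 0 ≤ ∑ v, s.2 v := Finset.sum_nonneg fun v _ => hs v
  split_ifs with h
  · have : (K - ∑ v, s.2 v) ^ n ≤ K ^ n := pow_le_pow_left₀ (by linarith) (by linarith) n
    gcongr
  · exact zero_le

theorem envelope_eq_zero {K : ℝ} (n : ℕ) {s : State V} (hs : K < ∑ v, s.2 v) :
    envelope K n s = 0 := if_neg (not_le.mpr hs)

/-- A stay integrates the envelope in the total local time, which raises the power by one. -/
theorem stay_envelope_le (β : V → V → ℝ) (K : ℝ) (n : ℕ) (s : State V) :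
    stay β (envelope K n) s ≤ envelope K (n + 1) s := by
  have h1 : stay β (envelope K n) s ≤ ∫⁻ τ in Set.Ioi (0 : ℝ),
      (Set.Iic (K - ∑ v, s.2 v)).indicator
        (fun τ => ENNReal.ofReal ((K - ∑ v, s.2 v - τ) ^ n / n.factorial)) τ := by
    refine setLIntegral_mono' measurableSet_Ioi fun τ hτ => ?_
    have h2 : Real.exp (-(clockRate β s * τ)) ≤ 1 := by
      rw [Real.exp_le_one_iff]
      have : 0 ≤ (clockRate β s : ℝ) * τ := mul_nonneg (NNReal.coe_nonneg _) (le_of_lt hτ)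
      linarith
    refine (mul_le_mul_left (ENNReal.ofReal_le_one.mpr h2) _).trans ?_
    rw [one_mul, envelope, sum_afterStay, Set.indicator_apply]
    by_cases h : ∑ v, s.2 v + τ ≤ K
    · rw [if_pos h, if_pos (by simp only [Set.mem_Iic]; linarith), sub_sub]
    · rw [if_neg h]; exact zero_le
  refine h1.trans ?_
  rw [lintegral_indicator measurableSet_Iic, Measure.restrict_restrict measurableSet_Iic,
    Set.inter_comm, Set.Ioi_inter_Iic]
  by_cases h : ∑ v, s.2 v ≤ K
  · set D := K - ∑ v, s.2 v with hD
    have hD0 : 0 ≤ D := by linarith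
    rw [envelope, if_pos h, ← ofReal_integral_eq_lintegral_ofReal,
      ← intervalIntegral.integral_of_le hD0]
    · refine le_of_eq (congrArg _ ?_)
      rw [intervalIntegral.integral_div,
        intervalIntegral.integral_comp_sub_left (fun x => x ^ n) D, integral_pow,
        Nat.factorial_succ]
      push_cast
      simp only [sub_self, sub_zero, ← hD]
      field_simp
      simp
    · exact (Continuous.integrableOn_Icc (by fun_prop)).mono_set Set.Ioc_subset_Icc_self
    · refine (ae_restrict_mem measurableSet_Ioc).mono fun τ hτ => ?_
      have : 0 ≤ D - τ := by linarith [hτ.2]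
      positivity
  · rw [Set.Ioc_eq_empty (by linarith)]
    simp

variable [MeasurableSpace V] [DiscreteMeasurableSpace V]

theorem jumpOp_envelope_le (β : V → V → ℝ) (K : ℝ) (n : ℕ) {s : State V} (hs : ∀ v, 0 ≤ s.2 v) :
    jumpOp β (envelope K n) s ≤ rateBound β K * envelope K n s := by
  have h1 (l : V) : envelope K n (l, s.2) = envelope K n s := rfl
  unfold jumpOp
  simp_rw [h1, ← Finset.sum_mul]
  by_cases h : ∑ v, s.2 v ≤ K
  · gcongr
    rw [← ENNReal.ofNNReal_finsetSum, ← Finset.mul_sum, sum_jumpProb, mul_one]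
    exact_mod_cast clockRate_le_rateBound β hs h
  · simp [envelope_eq_zero n (not_le.mp h)]

theorem stay_const_mul (β : V → V → ℝ) {M : ℝ≥0∞} (hM : M ≠ ∞) (f : State V → ℝ≥0∞)
    (s : State V) : stay β (fun s => M * f s) s = M * stay β f s := by
  unfold stay
  rw [← lintegral_const_mul' _ _ hM]
  exact lintegral_congr fun τ => by ring

theorem jumpOp_const_mul (β : V → V → ℝ) (M : ℝ≥0∞) (f : State V → ℝ≥0∞)
    (s : State V) : jumpOp β (fun s => M * f s) s = M * jumpOp β f s := by
  unfold jumpOp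
  rw [Finset.mul_sum]
  exact Finset.sum_congr rfl fun l _ => by ring

/-- `f` is at most `M` times the `n`-th envelope on states with nonnegative local times. -/
def EnvelopeBound (K : ℝ) (M : ℝ≥0) (n : ℕ) (f : State V → ℝ≥0∞) : Prop :=
  ∀ s : State V, (∀ v, 0 ≤ s.2 v) → f s ≤ M * envelope K n s

theorem EnvelopeBound.stay {K : ℝ} {M : ℝ≥0} {n : ℕ} {f : State V → ℝ≥0∞}
    (h : EnvelopeBound K M n f) (β : V → V → ℝ) : EnvelopeBound K M (n + 1) (stay β f) := by
  intro s hs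
  refine le_trans ?_ (mul_le_mul_right (stay_envelope_le β K n s) _)
  rw [← stay_const_mul β ENNReal.coe_ne_top]
  refine setLIntegral_mono' measurableSet_Ioi fun τ hτ => ?_
  gcongr
  refine h _ fun v => ?_
  by_cases hv : v = s.1
  · subst hv
    simpa [afterStay] using add_nonneg (hs _) (le_of_lt hτ)
  · simpa [afterStay, hv] using hs v

theorem EnvelopeBound.jumpOp {K : ℝ} {M : ℝ≥0} {n : ℕ} {f : State V → ℝ≥0∞}
    (h : EnvelopeBound K M n f) (β : V → V → ℝ) :
    EnvelopeBound K (rateBound β K * M) n (jumpOp β f) := by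
  intro s hs
  rw [ENNReal.coe_mul, mul_comm (rateBound β K : ℝ≥0∞), mul_assoc]
  refine le_trans ?_ (mul_le_mul_right (jumpOp_envelope_le β K n hs) _)
  rw [← jumpOp_const_mul]
  exact Finset.sum_le_sum fun l _ => by gcongr; exact h _ hs

theorem EnvelopeBound.iterate {K : ℝ} {M : ℝ≥0} {f : State V → ℝ≥0∞}
    (h : EnvelopeBound K M 0 f) (β : V → V → ℝ) (n : ℕ) :
    EnvelopeBound K (rateBound β K ^ n * M) n ((fun f => VRJP.jumpOp β (VRJP.stay β f))^[n] f) := by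
  induction n with
  | zero => simpa using h
  | succ n ih =>
    rw [Function.iterate_succ_apply', pow_succ', mul_assoc]
    exact (ih.stay β).jumpOp β

theorem EnvelopeBound.iterate_chain {K : ℝ} {M : ℝ≥0} {f : State V → ℝ≥0∞}
    (h : EnvelopeBound K M 0 f) (β : V → V → ℝ) (n : ℕ) :
    EnvelopeBound K (rateBound β K ^ n * M) n ((fun f => VRJP.stay β (VRJP.jumpOp β f))^[n] f) := by
  induction n with
  | zero => simpa using h
  | succ n ih =>
    rw [Function.iterate_succ_apply', pow_succ', mul_assoc]
    exact (ih.jumpOp β).stay β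

theorem tendsto_iterate_bound (C M : ℝ≥0) (K : ℝ) :
    Filter.Tendsto (fun n : ℕ => ((C ^ n * M : ℝ≥0) : ℝ≥0∞) *
      ENNReal.ofReal (K ^ n / n.factorial)) Filter.atTop (nhds 0) := by
  have h (n : ℕ) : ((C ^ n * M : ℝ≥0) : ℝ≥0∞) * ENNReal.ofReal (K ^ n / n.factorial)
      = ENNReal.ofReal (M * ((C * K) ^ n / n.factorial)) := by
    rw [← ENNReal.ofReal_coe_nnreal, ← ENNReal.ofReal_mul (by positivity)]
    congr 1
    push_cast
    rw [mul_pow]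
    ring
  simp_rw [h]
  have := (FloorSemiring.tendsto_pow_div_factorial_atTop ((C : ℝ) * K)).const_mul (M : ℝ)
  rw [mul_zero] at this
  simpa using ENNReal.tendsto_ofReal this

end VRJP

namespace VRJP

set_option linter.unusedSectionVars false

variable {V : Type*} [Fintype V] [DecidableEq V] [MeasurableSpace V] [DiscreteMeasurableSpace V]

/-! ### The law of the jump chain -/

instance (β : V → V → ℝ) (i : V) (ℓ : V → ℝ) : IsProbabilityMeasure (law β i ℓ) := by
  unfold law; infer_instance

theorem law_zero (β : V → V → ℝ) (i : V) (ℓ : V → ℝ) : ∀ᵐ ω ∂(law β i ℓ), ω 0 = (i, ℓ) := by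
  have h := congrArg (fun μ => μ {x | x ⟨0, Finset.mem_Iic.mpr le_rfl⟩ = (i, ℓ)}ᶜ)
    (Kernel.traj_map_frestrictLe_apply (X := fun _ => State V)
      (κ := fun n => (stepKernel β).comap
        (fun h : (k : Finset.Iic n) → State V => h ⟨n, Finset.mem_Iic.mpr le_rfl⟩)
        (measurable_pi_apply _)) 0 0 (fun _ => (i, ℓ)))
  have hm : MeasurableSet {x : (k : Finset.Iic 0) → State V |
      x ⟨0, Finset.mem_Iic.mpr le_rfl⟩ = (i, ℓ)} :=
    (measurableSet_singleton _).preimage (measurable_pi_apply _)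
  simp only [Kernel.partialTraj_self, Kernel.id_apply] at h
  rw [Measure.map_apply (by fun_prop) hm.compl, Measure.dirac_apply' _ hm.compl] at h
  rw [ae_iff]
  simpa [law, Set.preimage] using h

/-- The Markov property of the jump chain. -/
theorem lintegral_law_succ (β : V → V → ℝ) (i : V) (ℓ : V → ℝ) (n : ℕ)
    {f : State V × State V → ℝ≥0∞} (hf : Measurable f) :
    ∫⁻ ω, f (ω n, ω (n + 1)) ∂(law β i ℓ) =
      ∫⁻ ω, (∫⁻ s', f (ω n, s') ∂(stepKernel β (ω n))) ∂(law β i ℓ) := by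
  let κ : (n : ℕ) → Kernel ((k : Finset.Iic n) → State V) (State V) :=
    fun n => (stepKernel β).comap
      (fun h : (k : Finset.Iic n) → State V => h ⟨n, Finset.mem_Iic.mpr le_rfl⟩)
        (measurable_pi_apply _)
  let e : ((k : Finset.Iic n) → State V) → State V := fun h => h ⟨n, Finset.mem_Iic.mpr le_rfl⟩
  have he : Measurable e := measurable_pi_apply _
  have h := Kernel.partialTraj_compProd_eq_map_traj (X := fun _ => State V) (κ := κ)
    (Nat.zero_le n) (x₀ := fun _ => (i, ℓ))
  have hF : Measurable fun q : ((k : Finset.Iic n) → State V) × State V => f (e q.1, q.2) :=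
    hf.comp (by fun_prop)
  have h1 := congrArg (fun μ => ∫⁻ q, f (e q.1, q.2) ∂μ) h
  rw [Measure.lintegral_compProd hF, lintegral_map hF (by fun_prop),
    ← Kernel.traj_map_frestrictLe_apply, lintegral_map _ (by fun_prop)] at h1
  · exact h1.symm
  · exact Measurable.lintegral_kernel_prod_right' (κ := κ n) hF

theorem measurable_iterate (β : V → V → ℝ) (n : ℕ) {f : State V → ℝ≥0∞}
    (hf : Measurable f) : Measurable ((fun f => jumpOp β (stay β f))^[n] f) := by
  induction n generalizing f with
  | zero => exact hf
  | succ n ih => exact ih (measurable_jumpOp β (measurable_stay β hf))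

theorem iterate_chain_stay (β : V → V → ℝ) (n : ℕ) (f : State V → ℝ≥0∞) :
    (fun f => stay β (jumpOp β f))^[n] (stay β f) =
      stay β ((fun f => jumpOp β (stay β f))^[n] f) := by
  induction n generalizing f with
  | zero => rfl
  | succ n ih => exact ih (jumpOp β (stay β f))

theorem lintegral_law_apply {β : V → V → ℝ} (hβ : ∀ k, β k k = 0) (i : V) (ℓ : V → ℝ) (n : ℕ)
    {f : State V → ℝ≥0∞} (hf : Measurable f) :
    ∫⁻ ω, f (ω n) ∂(law β i ℓ) = (fun f => stay β (jumpOp β f))^[n] f (i, ℓ) := by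
  induction n generalizing f with
  | zero =>
    rw [lintegral_congr_ae ((law_zero β i ℓ).mono fun ω h => by rw [h])]
    simp
  | succ n ih =>
    rw [lintegral_law_succ β i ℓ n (f := fun q => f q.2) (hf.comp measurable_snd)]
    simp_rw [lintegral_stepKernel_eq_stay_jumpOp hβ _ hf]
    exact ih (measurable_stay β (measurable_jumpOp β hf))

theorem measurable_envelope (K : ℝ) (n : ℕ) :
    Measurable (envelope (V := V) K n) := by
  unfold envelope
  exact Measurable.ite (measurableSet_le (by fun_prop) measurable_const) (by fun_prop)
    measurable_const

/-- The total local time of the jump chain is almost surely unbounded, so that the process does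
not explode. -/
theorem ae_exists_lt_sum {β : V → V → ℝ} (hβ : ∀ k, β k k = 0) (i : V) {ℓ : V → ℝ}
    (hℓ : ∀ v, 0 ≤ ℓ v) : ∀ᵐ ω ∂(law β i ℓ), ∀ K : ℝ, ∃ n, K < ∑ v, (ω n).2 v := by
  have key (K : ℕ) : ∀ᵐ ω ∂(law β i ℓ), ∃ n, (K : ℝ) < ∑ v, (ω n).2 v := by
    rw [ae_iff]
    have hb : EnvelopeBound (V := V) K 1 0 (envelope K 0) := fun s _ => by simp
    refine le_antisymm (ge_of_tendsto' (tendsto_iterate_bound (rateBound β K) 1 K) fun n => ?_)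
      zero_le
    calc (law β i ℓ) {ω | ¬∃ n, (K : ℝ) < ∑ v, (ω n).2 v}
        ≤ ∫⁻ ω, envelope K 0 (ω n) ∂(law β i ℓ) := by
          have hm : MeasurableSet {ω : Path V | ∑ v, (ω n).2 v ≤ K} :=
            measurableSet_le (by fun_prop) measurable_const
          refine le_trans (measure_mono fun ω hω => ?_) (?_ :
            (law β i ℓ) {ω : Path V | ∑ v, (ω n).2 v ≤ K} ≤ _)
          · exact not_lt.mp fun h => hω ⟨n, h⟩
          · rw [← lintegral_indicator_one hm]
            refine lintegral_mono fun ω => ?_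
            by_cases h : ∑ v, (ω n).2 v ≤ K
            · simp [envelope, h]
            · simp [envelope, h]
      _ = (fun f => stay β (jumpOp β f))^[n] (envelope K 0) (i, ℓ) :=
          lintegral_law_apply hβ i ℓ n (measurable_envelope K 0)
      _ ≤ _ := (hb.iterate_chain β n (i, ℓ) hℓ).trans (by gcongr; exact envelope_le K n hℓ)
  filter_upwards [ae_all_iff.mpr key] with ω hω K
  obtain ⟨m, hm⟩ := exists_nat_gt K
  obtain ⟨n, hn⟩ := hω m
  exact ⟨n, hm.trans hn⟩

/-- Successive states of the jump chain differ by a stay of positive duration. -/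
theorem ae_eq_afterStay (β : V → V → ℝ) (i : V) (ℓ : V → ℝ) :
    ∀ᵐ ω ∂(law β i ℓ), ∀ n, ∃ τ : ℝ, 0 < τ ∧ ω (n + 1) = afterStay (ω n) (ω (n + 1)).1 τ := by
  let B : Set (State V × State V) :=
    {q | q.1.2 q.1.1 < q.2.2 q.1.1 ∧ ∀ v, v ≠ q.1.1 → q.2.2 v = q.1.2 v}
  have hdiag : Measurable fun q : (V → ℝ) × V => q.1 q.2 :=
    measurable_from_prod_countable_left fun v => measurable_pi_apply v
  have h1 : Measurable fun q : State V × State V => q.1.2 q.1.1 :=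
    hdiag.comp (by fun_prop : Measurable fun q : State V × State V => (q.1.2, q.1.1))
  have h2 : Measurable fun q : State V × State V => q.2.2 q.1.1 :=
    hdiag.comp (by fun_prop : Measurable fun q : State V × State V => (q.2.2, q.1.1))
  have hB : MeasurableSet B := by
    refine (measurableSet_lt h1 h2).inter ?_
    change MeasurableSet {q : State V × State V | ∀ v, v ≠ q.1.1 → q.2.2 v = q.1.2 v}
    rw [measurableSet_setOfPred]
    refine Measurable.forall fun v => measurableSet_setOfPred.mp ?_
    have h3 : MeasurableSet {q : State V × State V | q.1.1 = v} :=
      (measurableSet_singleton v).preimage (by fun_prop)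
    have h4 : MeasurableSet {q : State V × State V | q.2.2 v = q.1.2 v} :=
      measurableSet_eq_fun (by fun_prop) (by fun_prop)
    convert h3.union h4 using 1
    ext q
    simp only [Set.mem_ofPred_eq, Set.mem_union]
    tauto
  rw [ae_all_iff]
  intro n
  have h5 : ∫⁻ ω, Bᶜ.indicator 1 (ω n, ω (n + 1)) ∂(law β i ℓ) = 0 := by
    rw [lintegral_law_succ β i ℓ n (measurable_one.indicator hB.compl)]
    refine (lintegral_congr fun ω => ?_).trans lintegral_zero
    rw [lintegral_stepKernel β _ (f := fun s' => Bᶜ.indicator 1 (ω n, s'))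
      ((measurable_one.indicator hB.compl).comp (by fun_prop :
        Measurable fun s' : State V => (ω n, s')))]
    refine Finset.sum_eq_zero fun l _ => mul_eq_zero_of_right _ ?_
    refine (setLIntegral_congr_fun measurableSet_Ioi fun τ hτ => ?_).trans lintegral_zero
    have : (ω n, afterStay (ω n) l τ) ∈ B := by
      refine ⟨?_, fun v hv => ?_⟩
      · simpa [afterStay] using hτ
      · exact Function.update_of_ne hv _ _
    simp [this]
  have hm : Measurable fun ω : Path V => Bᶜ.indicator (1 : State V × State V → ℝ≥0∞)
      (ω n, ω (n + 1)) :=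
    (measurable_one.indicator hB.compl).comp (by fun_prop)
  rw [lintegral_eq_zero_iff hm] at h5
  filter_upwards [h5] with ω hω
  have h6 : (ω n, ω (n + 1)) ∈ B := by
    by_contra h
    simp [h] at hω
  refine ⟨(ω (n + 1)).2 (ω n).1 - (ω n).2 (ω n).1, sub_pos.mpr h6.1, Prod.ext rfl ?_⟩
  funext v
  by_cases hv : v = (ω n).1
  · subst hv; simp [afterStay]
  · simp only [afterStay, Function.update_of_ne hv]; exact h6.2 v hv

end VRJP

namespace VRJP

set_option linter.unusedSectionVars false

variable {V : Type*} [Fintype V] [DecidableEq V]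

/-! ### Reading the process off the jump chain -/

/-- A path of the jump chain along which every stay has positive duration and the total local
time is unbounded. Almost every path has this property. -/
structure IsRegular (ω : Path V) : Prop where
  exists_stay : ∀ n, ∃ τ : ℝ, 0 < τ ∧ ω (n + 1) = afterStay (ω n) (ω (n + 1)).1 τ
  unbounded : ∀ K : ℝ, ∃ n, K < ∑ v, (ω n).2 v

theorem jumpTime_eq (ω : Path V) (n : ℕ) :
    jumpTime ω n = ∑ v, (ω n).2 v - ∑ v, (ω 0).2 v := by
  simp [jumpTime]

theorem jumpTime_zero (ω : Path V) : jumpTime ω 0 = 0 := by simp [jumpTime]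

/-- The state of the process at time `t`: its position and its local times. -/
noncomputable def stateAt (ω : Path V) (t : ℝ) : State V := (pos ω t, localTime ω t)

namespace IsRegular

variable {ω : Path V}

theorem succ_eq (h : IsRegular ω) (n : ℕ) :
    ω (n + 1) = afterStay (ω n) (ω (n + 1)).1 (jumpTime ω (n + 1) - jumpTime ω n) := by
  obtain ⟨τ, -, h2⟩ := h.exists_stay n
  have h3 : jumpTime ω (n + 1) - jumpTime ω n = τ := by
    rw [jumpTime_eq, jumpTime_eq]
    nth_rw 1 [h2]
    rw [sum_afterStay]
    ring
  rw [h3]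
  exact h2

theorem strictMono (h : IsRegular ω) : StrictMono (jumpTime ω) := by
  refine strictMono_nat_of_lt_succ fun n => ?_
  obtain ⟨τ, h1, h2⟩ := h.exists_stay n
  rw [jumpTime_eq, jumpTime_eq, h2, sum_afterStay]
  linarith

theorem not_bddAbove (h : IsRegular ω) : ¬BddAbove (Set.range (jumpTime ω)) := by
  rintro ⟨K, hK⟩
  obtain ⟨n, hn⟩ := h.unbounded (K + ∑ v, (ω 0).2 v)
  have := hK ⟨n, rfl⟩
  rw [jumpTime_eq] at this
  linarith

theorem pos_eq (h : IsRegular ω) {n : ℕ} {t : ℝ}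
    (ht : t ∈ Set.Ico (jumpTime ω n) (jumpTime ω (n + 1))) : pos ω t = (ω n).1 := by
  have h1 : sInf {m : ℕ | t < jumpTime ω (m + 1)} = n := by
    refine IsLeast.csInf_eq ⟨ht.2, fun m hm => ?_⟩
    have h2 : jumpTime ω n < jumpTime ω (m + 1) := ht.1.trans_lt hm
    exact Nat.lt_succ_iff.mp (h.strictMono.lt_iff_lt.mp h2)
  simp only [pos, h1]

/-- The local time gained at `v` up to a time in the `n`-th stay. The indicator is integrable
because it is constant on each of the finitely many stays. -/
theorem integral_pos (h : IsRegular ω) (v : V) (n : ℕ) :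
    ∀ t ∈ Set.Icc (jumpTime ω n) (jumpTime ω (n + 1)),
      IntervalIntegrable (fun s => if pos ω s = v then (1 : ℝ) else 0) volume 0 t ∧
      ∫ s in (0 : ℝ)..t, (if pos ω s = v then (1 : ℝ) else 0) =
        (afterStay (ω n) (ω n).1 (t - jumpTime ω n)).2 v - (ω 0).2 v := by
  have hpiece (n : ℕ) (t : ℝ) (ht : t ∈ Set.Icc (jumpTime ω n) (jumpTime ω (n + 1))) :
      Set.EqOn (fun s => if pos ω s = v then (1 : ℝ) else 0)
        (fun _ => if (ω n).1 = v then (1 : ℝ) else 0) (Set.Ioo (jumpTime ω n) t) := by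
    intro s hs
    simp only
    rw [h.pos_eq ⟨hs.1.le, hs.2.trans_le ht.2⟩]
  have hint (n : ℕ) (t : ℝ) (ht : t ∈ Set.Icc (jumpTime ω n) (jumpTime ω (n + 1))) :
      IntervalIntegrable (fun s => if pos ω s = v then (1 : ℝ) else 0) volume (jumpTime ω n) t := by
    refine IntervalIntegrable.congr_uIoo
      (f := fun _ => if (ω n).1 = v then (1 : ℝ) else 0) intervalIntegrable_const ?_
    rw [Set.uIoo_of_le ht.1]
    exact (hpiece n t ht).symm
  have hval (n : ℕ) (t : ℝ) (ht : t ∈ Set.Icc (jumpTime ω n) (jumpTime ω (n + 1))) :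
      ∫ s in (jumpTime ω n)..t, (if pos ω s = v then (1 : ℝ) else 0) =
        (afterStay (ω n) (ω n).1 (t - jumpTime ω n)).2 v - (ω n).2 v := by
    rw [intervalIntegral.integral_congr_Ioo_of_le ht.1 (hpiece n t ht),
      intervalIntegral.integral_const]
    by_cases hv : (ω n).1 = v
    · subst hv; simp [afterStay]
    · simp [afterStay, hv, Function.update_of_ne (Ne.symm hv)]
  induction n with
  | zero =>
    intro t ht
    have h1 := hint 0 t ht
    have h2 := hval 0 t ht
    rw [jumpTime_zero] at h1 h2
    exact ⟨h1, by rw [h2, jumpTime_zero]⟩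
  | succ n ih =>
    intro t ht
    obtain ⟨h1, h2⟩ := ih (jumpTime ω (n + 1))
      (Set.right_mem_Icc.mpr (h.strictMono (Nat.lt_succ_self n)).le)
    refine ⟨h1.trans (hint (n + 1) t ht), ?_⟩
    rw [← intervalIntegral.integral_add_adjacent_intervals h1 (hint (n + 1) t ht), h2,
      hval (n + 1) t ht]
    have h3 := congrArg (fun s : State V => s.2 v) (h.succ_eq n)
    simp only [afterStay] at h3 ⊢
    rw [← h3]
    ring

theorem stateAt_eq (h : IsRegular ω) {n : ℕ} {t : ℝ}
    (ht : t ∈ Set.Ico (jumpTime ω n) (jumpTime ω (n + 1))) :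
    stateAt ω t = afterStay (ω n) (ω n).1 (t - jumpTime ω n) := by
  refine Prod.ext (h.pos_eq ht) ?_
  funext v
  simp only [stateAt, localTime]
  rw [(h.integral_pos v n t (Set.Ico_subset_Icc_self ht)).2]
  ring

/-- The occupation integral of `g`, split according to the stays. -/
theorem lintegral_stateAt (h : IsRegular ω) (g : State V → ℝ≥0∞) :
    ∫⁻ t in Set.Ioi (0 : ℝ), g (stateAt ω t) =
      ∑' n, ∫⁻ τ in Set.Ioo (0 : ℝ) (∑ v, (ω (n + 1)).2 v - ∑ v, (ω n).2 v),
        g (afterStay (ω n) (ω n).1 τ) := by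
  have hU := iUnion_Ico_map_succ_eq_Ici (f := jumpTime ω)
    (fun n => by
      rw [Nat.bot_eq_zero]
      exact h.strictMono.monotone (Nat.zero_le n)) h.not_bddAbove
  rw [Nat.bot_eq_zero, jumpTime_zero] at hU
  rw [setLIntegral_congr Ioi_ae_eq_Ici, ← hU,
    lintegral_iUnion (fun n => measurableSet_Ico)
      h.strictMono.monotone.pairwise_disjoint_on_Ico_succ]
  refine tsum_congr fun n => ?_
  rw [setLIntegral_congr_fun measurableSet_Ico (fun t ht => by rw [h.stateAt_eq ht]),
    ← setLIntegral_congr Ioo_ae_eq_Ico, ← lintegral_indicator measurableSet_Ioo,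
    ← lintegral_indicator measurableSet_Ioo,
    ← lintegral_add_right_eq_self (μ := volume) _ (jumpTime ω n)]
  refine lintegral_congr fun τ => ?_
  have h1 : τ + jumpTime ω n ∈ Set.Ioo (jumpTime ω n) (jumpTime ω (Order.succ n)) ↔
      τ ∈ Set.Ioo 0 (∑ v, (ω (n + 1)).2 v - ∑ v, (ω n).2 v) := by
    have h2 : jumpTime ω (Order.succ n) = ∑ v, (ω (n + 1)).2 v - ∑ v, (ω 0).2 v :=
      jumpTime_eq ω (n + 1)
    rw [h2, jumpTime_eq, Set.mem_Ioo, Set.mem_Ioo]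
    constructor <;> rintro ⟨h3, h4⟩ <;> constructor <;> linarith
  simp only [Set.indicator_apply, h1, add_sub_cancel_right]

end IsRegular

variable [MeasurableSpace V] [DiscreteMeasurableSpace V]

theorem ae_isRegular {β : V → V → ℝ} (hβ : ∀ k, β k k = 0) (i : V) {ℓ : V → ℝ}
    (hℓ : ∀ v, 0 ≤ ℓ v) : ∀ᵐ ω ∂(law β i ℓ), IsRegular ω := by
  filter_upwards [ae_eq_afterStay β i ℓ, ae_exists_lt_sum hβ i hℓ] with ω h1 h2
  exact ⟨h1, h2⟩

/-- The potential of `g`: the sum over the number of jumps of the expected integral of `g` along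
the stay after that many jumps. -/
noncomputable def potential (β : V → V → ℝ) (g : State V → ℝ≥0∞) (s : State V) : ℝ≥0∞ :=
  ∑' n, stay β ((fun f => jumpOp β (stay β f))^[n] g) s

theorem measurable_potential (β : V → V → ℝ) {g : State V → ℝ≥0∞} (hg : Measurable g) :
    Measurable (potential β g) :=
  Measurable.tsum fun n => measurable_stay β (measurable_iterate β n hg)

/-- The expected total occupation integral of `g` is the potential of `g`. -/
theorem lintegral_lintegral_stateAt {β : V → V → ℝ} (hβ : ∀ k, β k k = 0) (i : V) {ℓ : V → ℝ}
    (hℓ : ∀ v, 0 ≤ ℓ v) {g : State V → ℝ≥0∞} (hg : Measurable g) :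
    ∫⁻ ω, ∫⁻ t in Set.Ioi (0 : ℝ), g (stateAt ω t) ∂volume ∂(law β i ℓ) =
      potential β g (i, ℓ) := by
  let F : State V × State V → ℝ≥0∞ := fun q =>
      ∫⁻ τ in Set.Ioo (0 : ℝ) (∑ v, q.2.2 v - ∑ v, q.1.2 v), g (afterStay q.1 q.1.1 τ)
  have hF : Measurable F := by
    have h1 (q : State V × State V) :
        F q
        = ∫⁻ τ, {x : (State V × State V) × ℝ | 0 < x.2 ∧
            x.2 < ∑ v, x.1.2.2 v - ∑ v, x.1.1.2 v}.indicator
            (fun x => g (afterStay x.1.1 x.1.1.1 x.2)) (q, τ) := by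
      simp only [F]
      rw [← lintegral_indicator measurableSet_Ioo]
      rfl
    rw [funext h1]
    refine Measurable.lintegral_prod_right' (Measurable.indicator ?_ ?_)
    · exact hg.comp (measurable_afterStay_self.comp (by fun_prop :
        Measurable fun x : (State V × State V) × ℝ => (x.1.1, x.2)))
    · exact (measurableSet_lt measurable_const measurable_snd).inter
        (measurableSet_lt measurable_snd (by fun_prop))
  rw [lintegral_congr_ae ((ae_isRegular hβ i hℓ).mono fun ω h => h.lintegral_stateAt g),
    lintegral_tsum (f := fun n (ω : Path V) => F (ω n, ω (n + 1)))
      fun n => (hF.comp (by fun_prop :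
      Measurable fun ω : Path V => (ω n, ω (n + 1)))).aemeasurable]
  refine tsum_congr fun n => ?_
  rw [lintegral_law_succ β i ℓ n hF]
  simp only [F]
  simp_rw [lintegral_stepKernel_stay β _ hg]
  rw [lintegral_law_apply hβ i ℓ n (measurable_stay β hg), iterate_chain_stay]

theorem measurable_jumpTime (n : ℕ) : Measurable fun ω : Path V => jumpTime ω n := by
  unfold jumpTime; fun_prop

theorem measurable_pos : Measurable fun q : Path V × ℝ => pos q.1 q.2 := by
  have hS (n : ℕ) : MeasurableSet {q : Path V × ℝ | q.2 < jumpTime q.1 (n + 1)} :=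
    measurableSet_lt measurable_snd ((measurable_jumpTime (n + 1)).comp measurable_fst)
  have hN : Measurable fun q : Path V × ℝ => sInf {n : ℕ | q.2 < jumpTime q.1 (n + 1)} := by
    refine measurable_to_countable' fun n => ?_
    -- The infimum is `n` if `n` is the least element, or if `n = 0` and the set is empty.
    have h1 : (fun q : Path V × ℝ => sInf {n : ℕ | q.2 < jumpTime q.1 (n + 1)}) ⁻¹' {n} =
        {q | q.2 < jumpTime q.1 (n + 1) ∧ ∀ k, k < n → ¬q.2 < jumpTime q.1 (k + 1)} ∪
        {q | n = 0 ∧ ∀ k, ¬q.2 < jumpTime q.1 (k + 1)} := by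
      ext q
      simp only [Set.mem_preimage, Set.mem_singleton_iff, Set.mem_union, Set.mem_ofPred_eq]
      constructor
      · intro h
        by_cases he : {m : ℕ | q.2 < jumpTime q.1 (m + 1)}.Nonempty
        · left
          subst h
          exact ⟨Nat.sInf_mem he, fun k hk => Nat.notMem_of_lt_sInf hk⟩
        · right
          rw [Set.not_nonempty_iff_eq_empty] at he
          refine ⟨by rw [← h, he, Nat.sInf_empty], fun k hk => ?_⟩
          have : k ∈ {m : ℕ | q.2 < jumpTime q.1 (m + 1)} := hk
          rw [he] at this
          exact this
      · rintro (⟨h2, h3⟩ | ⟨h2, h3⟩)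
        · exact IsLeast.csInf_eq ⟨h2, fun m hm => not_lt.mp fun hlt => h3 m hlt hm⟩
        · have : {m : ℕ | q.2 < jumpTime q.1 (m + 1)} = ∅ :=
            Set.eq_empty_iff_forall_notMem.mpr h3
          rw [this, Nat.sInf_empty, h2]
    rw [h1]
    refine MeasurableSet.union ((hS n).inter ?_) (MeasurableSet.inter (.const _) ?_)
    · exact measurableSet_setOfPred.mpr (Measurable.forall fun k => Measurable.imp
        measurable_const (measurableSet_setOfPred.mp (hS k).compl))
    · exact measurableSet_setOfPred.mpr (Measurable.forall fun k =>
        measurableSet_setOfPred.mp (hS k).compl)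
  have h2 : Measurable fun x : ℕ × (Path V × ℝ) => (x.2.1 x.1).1 :=
    measurable_from_prod_countable_right fun n => measurable_fst.comp
      ((measurable_pi_apply n).comp measurable_fst)
  exact h2.comp (hN.prodMk measurable_id)

theorem measurable_localTime : Measurable fun q : Path V × ℝ => localTime q.1 q.2 := by
  refine measurable_pi_iff.mpr fun v => ?_
  unfold localTime
  refine Measurable.add (by fun_prop) ?_
  have h1 : Measurable fun x : (Path V × ℝ) × ℝ => if pos x.1.1 x.2 = v then (1 : ℝ) else 0 :=
    (Measurable.of_discrete (f := fun w : V => if w = v then (1 : ℝ) else 0)).comp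
      (measurable_pos.comp (by fun_prop :
        Measurable fun x : (Path V × ℝ) × ℝ => (x.1.1, x.2)))
  simp only [intervalIntegral]
  simp_rw [← integral_indicator measurableSet_Ioc]
  refine Measurable.sub ?_ ?_
  · refine (StronglyMeasurable.integral_prod_right' (f := fun x : (Path V × ℝ) × ℝ =>
      (Set.Ioc 0 x.1.2).indicator (fun s => if pos x.1.1 s = v then (1 : ℝ) else 0) x.2)
      (Measurable.stronglyMeasurable ?_)).measurable
    exact Measurable.ite ((measurableSet_lt measurable_const measurable_snd).inter
      (measurableSet_le measurable_snd (by fun_prop))) h1 measurable_const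
  · refine (StronglyMeasurable.integral_prod_right' (f := fun x : (Path V × ℝ) × ℝ =>
      (Set.Ioc x.1.2 0).indicator (fun s => if pos x.1.1 s = v then (1 : ℝ) else 0) x.2)
      (Measurable.stronglyMeasurable ?_)).measurable
    exact Measurable.ite ((measurableSet_lt (by fun_prop) measurable_snd).inter
      (measurableSet_le measurable_snd measurable_const)) h1 measurable_const

theorem measurable_stateAt : Measurable fun q : Path V × ℝ => stateAt q.1 q.2 :=
  measurable_pos.prodMk measurable_localTime

end VRJP

namespace H2Model

/-! ### Integration by parts along a hyperbola -/

section Hyperbola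

variable {m : ℝ}

theorem le_sqrt_sq_add_sq (m : ℝ) (x : ℝ) : m ≤ √(m ^ 2 + x ^ 2) :=
  Real.le_sqrt_of_sq_le (by nlinarith [sq_nonneg x])

theorem abs_le_sqrt_sq_add_sq (x : ℝ) : |x| ≤ √(m ^ 2 + x ^ 2) :=
  Real.abs_le_sqrt (by nlinarith [sq_nonneg m])

theorem hasDerivAt_sqrt_sq_add_sq (hm : 0 < m) (x : ℝ) :
    HasDerivAt (fun x => √(m ^ 2 + x ^ 2)) (x / √(m ^ 2 + x ^ 2)) x := by
  have h := ((hasDerivAt_pow 2 x).const_add (m ^ 2)).sqrt (by positivity)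
  convert h using 1
  field_simp
  simp [mul_comm]

theorem image_sqrt_sq_add_sq (hm : 0 < m) :
    (fun x => √(m ^ 2 + x ^ 2)) '' Set.Ioi 0 = Set.Ioi m := by
  ext s
  constructor
  · rintro ⟨x, hx, rfl⟩
    have hx : 0 < x := hx
    exact Real.lt_sqrt_of_sq_lt (by nlinarith)
  · intro hs
    have hs : m < s := hs
    refine ⟨√(s ^ 2 - m ^ 2), Real.sqrt_pos.mpr (by nlinarith), ?_⟩
    simp only
    rw [Real.sq_sqrt (by nlinarith), add_sub_cancel, Real.sqrt_sq (by linarith)]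

theorem integrable_of_bounded_of_support {E : Type*} [MeasurableSpace E] {μ : Measure E}
    {f : E → ℝ} (hf : Measurable f) {S : Set E} (hS : μ S ≠ ∞) (B : ℝ)
    (hB : ∀ x ∈ S, |f x| ≤ B) (h0 : ∀ x ∉ S, f x = 0) : Integrable f μ := by
  have hsub : S ⊆ toMeasurable μ S := subset_toMeasurable μ S
  have h1 : IntegrableOn f (toMeasurable μ S) μ := by
    refine Measure.integrableOn_of_bounded (M := max B 0) (by rwa [measure_toMeasurable])
      hf.aestronglyMeasurable (Filter.Eventually.of_forall fun x => ?_)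
    by_cases hx : x ∈ S
    · exact (hB x hx).trans (le_max_left _ _)
    · simp [h0 x hx]
  rwa [integrableOn_iff_integrable_of_support_subset] at h1
  intro x hx
  by_contra h
  exact hx (h0 x fun hS => h (hsub hS))

variable {W W' G : ℝ → ℝ} {B K : ℝ}

/-- Substitution `s = √(m² + x²)` on each of the half-lines `x > 0` and `x < 0`. -/
theorem integral_mul_comp_sqrt (hm : 0 < m) (hW : Continuous W) (hG : Measurable G)
    (hB : ∀ s, m ≤ s → |G s| ≤ B) (hK : ∀ s, m ≤ s → K < s → G s = 0) :
    Integrable (fun x => W x * G (√(m ^ 2 + x ^ 2)) * (x / √(m ^ 2 + x ^ 2))) ∧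
    ∫ x, W x * G (√(m ^ 2 + x ^ 2)) * (x / √(m ^ 2 + x ^ 2)) =
      ∫ s in Set.Ioi m, (W (√(s ^ 2 - m ^ 2)) - W (-√(s ^ 2 - m ^ 2))) * G s := by
  set r : ℝ → ℝ := fun x => √(m ^ 2 + x ^ 2) with hr
  have hrm : Measurable r := by fun_prop
  have hr0 (x : ℝ) : 0 < r x := hm.trans_le (le_sqrt_sq_add_sq m x)
  set f : ℝ → ℝ := fun x => W x * G (r x) * (x / r x) with hf
  have hint : Integrable f := by
    obtain ⟨C, hC⟩ := (isCompact_Icc (a := -K) (b := K)).exists_bound_of_continuousOn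
      hW.continuousOn
    refine integrable_of_bounded_of_support (S := Set.Icc (-K) K)
      ((hW.measurable.mul (hG.comp hrm)).mul (by fun_prop)) (by simp) (C * B) (fun x hx => ?_)
      fun x hx => ?_
    · have h1 : |x / r x| ≤ 1 := by
        rw [abs_div, abs_of_pos (hr0 x), div_le_one (hr0 x)]
        exact abs_le_sqrt_sq_add_sq x
      rw [hf, abs_mul, abs_mul]
      have h2 := hC x hx
      have h3 := hB (r x) (le_sqrt_sq_add_sq m x)
      have h4 : |W x| * |G (r x)| ≤ C * B :=
        mul_le_mul h2 h3 (abs_nonneg _) ((abs_nonneg _).trans h2)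
      nlinarith [abs_nonneg (x / r x), mul_nonneg (abs_nonneg (W x)) (abs_nonneg (G (r x)))]
    · have h1 : K < r x := by
        refine lt_of_lt_of_le ?_ (abs_le_sqrt_sq_add_sq x)
        by_contra h
        exact hx (abs_le.mp (not_lt.mp h))
      simp only [hf, hK (r x) (le_sqrt_sq_add_sq m x) h1, mul_zero, zero_mul]
  refine ⟨hint, ?_⟩
  rw [← integral_add_compl (s := Set.Iic (0 : ℝ)) measurableSet_Iic hint, Set.compl_Iic,
    ← neg_zero, ← integral_comp_neg_Ioi, neg_zero,
    ← integral_add ((hint.comp_neg).integrableOn) hint.integrableOn, ← image_sqrt_sq_add_sq hm,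
    integral_image_eq_integral_abs_deriv_smul measurableSet_Ioi
      (fun x _ => (hasDerivAt_sqrt_sq_add_sq hm x).hasDerivWithinAt)]
  · refine setIntegral_congr_fun measurableSet_Ioi fun x hx => ?_
    have hx : 0 < x := hx
    have h1 : √(r x ^ 2 - m ^ 2) = x := by
      rw [hr, Real.sq_sqrt (by positivity), add_sub_cancel_left, Real.sqrt_sq hx.le]
    have h2 : r (-x) = r x := by simp [hr]
    simp only [smul_eq_mul]
    rw [show √(m ^ 2 + x ^ 2) = r x from rfl, h1, abs_of_pos (div_pos hx (hr0 x))]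
    simp only [hf, h2]
    ring
  · intro x hx y hy hxy
    have hx : 0 < x := hx
    have hy : 0 < y := hy
    simp only at hxy
    rw [Real.sqrt_inj (by positivity) (by positivity)] at hxy
    exact (pow_left_inj₀ hx.le hy.le two_ne_zero).mp (by linarith)

/-- Integrating `W'` first, over the interval `√(m² + x²) < s`, leaves the increment of `W`. -/
theorem integral_deriv_mul_tail (hm : 0 < m) (hW : ∀ x, HasDerivAt W (W' x) x)
    (hW' : Continuous W') (hG : Measurable G)
    (hB : ∀ s, m ≤ s → |G s| ≤ B) (hK : ∀ s, m ≤ s → K < s → G s = 0) :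
    Integrable (fun x => W' x * ∫ s in Set.Ioi (√(m ^ 2 + x ^ 2)), G s) ∧
    ∫ x, W' x * ∫ s in Set.Ioi (√(m ^ 2 + x ^ 2)), G s =
      ∫ s in Set.Ioi m, (W (√(s ^ 2 - m ^ 2)) - W (-√(s ^ 2 - m ^ 2))) * G s := by
  set r : ℝ → ℝ := fun x => √(m ^ 2 + x ^ 2) with hr
  have hrm : Measurable r := by fun_prop
  have hmr (x : ℝ) : m ≤ r x := le_sqrt_sq_add_sq m x
  let E : Set (ℝ × ℝ) := {q | r q.1 < q.2 ∧ q.2 ≤ K}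
  have hE : MeasurableSet E := (measurableSet_lt (by fun_prop) measurable_snd).inter
    (measurableSet_le measurable_snd measurable_const)
  let h : ℝ × ℝ → ℝ := E.indicator fun q => W' q.1 * G q.2
  have hEsub : E ⊆ Set.Icc (-K) K ×ˢ Set.Icc m K := by
    rintro ⟨x, s⟩ ⟨h1, h2⟩
    simp only at h1 h2
    have h3 : |x| ≤ K := (abs_le_sqrt_sq_add_sq (m := m) x).trans (h1.le.trans h2)
    exact ⟨abs_le.mp h3, (hmr x).trans h1.le, h2⟩
  have hint : Integrable h (volume.prod volume) := by
    obtain ⟨C, hC⟩ := (isCompact_Icc (a := -K) (b := K)).exists_bound_of_continuousOn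
      hW'.continuousOn
    refine integrable_of_bounded_of_support (S := E)
      (((hW'.measurable.comp measurable_fst).mul (hG.comp measurable_snd)).indicator hE)
      ?_ (C * B) (fun q hq => ?_) fun q hq => Set.indicator_of_notMem hq _
    · refine ne_top_of_le_ne_top ?_ (measure_mono hEsub)
      rw [Measure.prod_prod]
      exact ENNReal.mul_ne_top (by simp) (by simp)
    · simp only [h, Set.indicator_of_mem hq, abs_mul]
      have h2 := hC q.1 (hEsub hq).1
      exact mul_le_mul h2 (hB _ (hEsub hq).2.1) (abs_nonneg _) ((abs_nonneg _).trans h2)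
  have hx (x : ℝ) : ∫ s, h (x, s) = W' x * ∫ s in Set.Ioi (r x), G s := by
    rw [← integral_const_mul, ← integral_indicator measurableSet_Ioi]
    refine integral_congr_ae (Filter.Eventually.of_forall fun s => ?_)
    simp only [h, Set.indicator_apply, E, Set.mem_ofPred_eq, Set.mem_Ioi]
    by_cases h1 : r x < s
    · by_cases h2 : s ≤ K
      · simp [h1, h2]
      · simp [h1, h2, hK s ((hmr x).trans h1.le) (not_le.mp h2)]
    · simp [h1]
  have hs (s : ℝ) : ∫ x, h (x, s) = (Set.Ioi m).indicator
      (fun s => (W (√(s ^ 2 - m ^ 2)) - W (-√(s ^ 2 - m ^ 2))) * G s) s := by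
    by_cases hms : m < s
    · rw [Set.indicator_of_mem (Set.mem_Ioi.mpr hms)]
      by_cases h2 : s ≤ K
      · set ρ := √(s ^ 2 - m ^ 2) with hρ
        have hρ0 : 0 ≤ ρ := Real.sqrt_nonneg _
        have h3 (x : ℝ) : r x < s ↔ x ∈ Set.Ioo (-ρ) ρ := by
          rw [Set.mem_Ioo, ← abs_lt, hρ, Real.lt_sqrt (abs_nonneg x), hr,
            Real.sqrt_lt' (hm.trans hms), sq_abs]
          constructor <;> intro h <;> linarith
        have h4 (x : ℝ) : h (x, s) = (Set.Ioo (-ρ) ρ).indicator (fun x => W' x * G s) x := by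
          simp only [h, Set.indicator_apply, E, Set.mem_ofPred_eq, h3, h2, and_true]
        simp_rw [h4]
        rw [integral_indicator measurableSet_Ioo, ← integral_Ioc_eq_integral_Ioo,
          ← intervalIntegral.integral_of_le (by linarith), intervalIntegral.integral_mul_const,
          intervalIntegral.integral_eq_sub_of_hasDerivAt (fun x _ => hW x)
            (hW'.intervalIntegrable _ _)]
      · rw [hK s hms.le (not_le.mp h2), mul_zero]
        simp [h, E, h2]
    · rw [Set.indicator_of_notMem (by simpa using hms)]
      have h3 (x : ℝ) : h (x, s) = 0 :=
        Set.indicator_of_notMem (fun hq => hms ((hmr x).trans_lt hq.1)) _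
      simp [h3]
  refine ⟨by simpa only [hx] using hint.integral_prod_left, ?_⟩
  change ∫ x, W' x * ∫ s in Set.Ioi (r x), G s = _
  simp only [← hx]
  rw [integral_integral_swap (f := fun x s => h (x, s)) hint]
  simp_rw [hs]
  rw [integral_indicator measurableSet_Ioi]

/-- The function `W x * Φ (√(m² + x²))`, where `Φ ρ` is the integral of `G` over `(ρ, ∞)`, has
compact support, and the integral of its derivative vanishes. As `G` is only measurable, this is
proved by interchanging the integrals, and not by differentiation. -/
theorem integral_deriv_mul_tail_sub (hm : 0 < m) (hW : ∀ x, HasDerivAt W (W' x) x)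
    (hW' : Continuous W') (hG : Measurable G)
    (hB : ∀ s, m ≤ s → |G s| ≤ B) (hK : ∀ s, m ≤ s → K < s → G s = 0) :
    ∫ x, (W' x * (∫ s in Set.Ioi (√(m ^ 2 + x ^ 2)), G s) -
      W x * G (√(m ^ 2 + x ^ 2)) * (x / √(m ^ 2 + x ^ 2))) = 0 := by
  have hWc : Continuous W := continuous_iff_continuousAt.mpr fun x => (hW x).continuousAt
  have h1 := integral_deriv_mul_tail hm hW hW' hG hB hK
  have h2 := integral_mul_comp_sqrt hm hWc hG hB hK
  rw [integral_sub h1.1 h2.1, h1.2, h2.2, sub_self]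

end Hyperbola

end H2Model

namespace H2Model

set_option linter.unusedSectionVars false

variable {V : Type*} [Fintype V] [DecidableEq V]

/-! ### The Gibbs measure on slices -/

/-- An integrable function of a spin configuration has integral zero if all its integrals over the
`x`-coordinate of one fixed vertex vanish. -/
theorem integral_eq_zero_of_slices {f : (V → ℝ × ℝ) → ℝ} (hf : Integrable f) (j : V)
    (h : ∀ p y, ∫ x, f (Function.update p j (x, y)) = 0) : ∫ p, f p = 0 := by
  let e := MeasurableEquiv.piEquivPiSubtypeProd (fun _ : V => ℝ × ℝ) (· = j)
  have he : MeasurePreserving e.symm := by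
    convert (volume_preserving_piEquivPiSubtypeProd (fun _ : V => ℝ × ℝ) (· = j)).symm
  rw [← he.integral_comp e.symm.measurableEmbedding]
  have hint : Integrable (fun q => f (e.symm q)) :=
    (he.integrable_comp_emb e.symm.measurableEmbedding).mpr hf
  rw [Measure.volume_eq_prod] at hint ⊢
  rw [integral_prod_symm _ hint]
  refine (integral_congr_ae (Filter.Eventually.of_forall fun b => ?_)).trans (integral_zero _ _)
  have hu : MeasurePreserving (MeasurableEquiv.funUnique {v // v = j} (ℝ × ℝ)).symm :=
    (volume_preserving_funUnique {v // v = j} (ℝ × ℝ)).symm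
  rw [← hu.integral_comp (MeasurableEquiv.measurableEmbedding _)]
  have h1 (q : ℝ × ℝ) :
      e.symm ((MeasurableEquiv.funUnique {v // v = j} (ℝ × ℝ)).symm q, b) =
        Function.update (e.symm (fun _ => 0, b)) j q := by
    funext v
    by_cases hv : v = j
    · subst hv
      simp [e, MeasurableEquiv.piEquivPiSubtypeProd, Equiv.piEquivPiSubtypeProd]
    · simp [e, MeasurableEquiv.piEquivPiSubtypeProd, Equiv.piEquivPiSubtypeProd, hv]
  simp_rw [h1]
  by_cases hi : Integrable (fun q : ℝ × ℝ => f (Function.update (e.symm (fun _ => 0, b)) j q))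
  · rw [Measure.volume_eq_prod] at hi ⊢
    rw [integral_prod_symm _ hi]
    simp [h]
  · exact integral_undef hi

theorem one_le_zCoord (q : ℝ × ℝ) : 1 ≤ zCoord q :=
  Real.one_le_sqrt.mpr (by nlinarith [sq_nonneg q.1, sq_nonneg q.2])

theorem zCoord_pos (q : ℝ × ℝ) : 0 < zCoord q := zero_lt_one.trans_le (one_le_zCoord q)

theorem abs_fst_le_zCoord (q : ℝ × ℝ) : |q.1| ≤ zCoord q :=
  Real.abs_le_sqrt (by nlinarith [sq_nonneg q.2])

theorem abs_snd_le_zCoord (q : ℝ × ℝ) : |q.2| ≤ zCoord q :=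
  Real.abs_le_sqrt (by nlinarith [sq_nonneg q.1])

theorem continuous_zCoord : Continuous zCoord := by
  unfold zCoord; fun_prop

theorem continuous_spin : Continuous spin := by
  unfold spin
  have := continuous_zCoord
  fun_prop

theorem continuous_action (β : V → V → ℝ) (h : ℝ) : Continuous (action β h) := by
  have h1 := continuous_zCoord
  have h2 (i : V) : Continuous fun p : V → ℝ × ℝ => spin (p i) :=
    continuous_spin.comp (continuous_apply i)
  have h3 : Continuous fun q : (ℝ × ℝ × ℝ) × (ℝ × ℝ × ℝ) => mink q.1 q.2 := by
    unfold mink; fun_prop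
  have h4 (i j : V) : Continuous fun p : V → ℝ × ℝ =>
      mink (spin (p i) - spin (p j)) (spin (p i) - spin (p j)) :=
    h3.comp (((h2 i).sub (h2 j)).prodMk ((h2 i).sub (h2 j)))
  unfold action
  fun_prop

/-- The density of the Gibbs measure without external field. -/
noncomputable def gibbsDensity (β : V → V → ℝ) (p : V → ℝ × ℝ) : ℝ :=
  (∏ i, (zCoord (p i))⁻¹) * Real.exp (-action β 0 p)

theorem gibbsDensity_nonneg (β : V → V → ℝ) (p : V → ℝ × ℝ) : 0 ≤ gibbsDensity β p :=
  mul_nonneg (Finset.prod_nonneg fun _ _ => inv_nonneg.mpr (zCoord_pos _).le) (Real.exp_nonneg _)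

theorem continuous_gibbsDensity (β : V → V → ℝ) : Continuous (gibbsDensity β) := by
  have h1 := continuous_action β 0
  unfold gibbsDensity
  refine Continuous.mul (continuous_finsetProd _ fun i _ => Continuous.inv₀
    (continuous_zCoord.comp (continuous_apply i)) fun p => (zCoord_pos _).ne') (by fun_prop)

theorem measurable_zField : Measurable (zField (V := V)) :=
  measurable_pi_iff.mpr fun i => continuous_zCoord.measurable.comp (measurable_pi_apply i)

theorem zField_pos (p : V → ℝ × ℝ) (v : V) : 0 < zField p v := zCoord_pos _

theorem gibbs_eq (β : V → V → ℝ) :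
    gibbs β 0 = volume.withDensity fun p => ENNReal.ofReal (gibbsDensity β p) := rfl

theorem zField_le_of_sum_le {K : ℝ} {p : V → ℝ × ℝ} (hp : ∑ v, zField p v ≤ K) (v : V) :
    zField p v ≤ K :=
  (Finset.single_le_sum (fun v _ => (zField_pos p v).le) (Finset.mem_univ v)).trans hp

theorem gibbs_sum_zField_le_ne_top (β : V → V → ℝ) (K : ℝ) :
    gibbs β 0 {p | ∑ v, zField p v ≤ K} ≠ ∞ := by
  have h1 : IsLocallyFiniteMeasure (gibbs β 0) := by
    rw [gibbs_eq]
    exact IsLocallyFiniteMeasure.withDensity_ofReal (continuous_gibbsDensity β)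
  have h2 : IsCompact (Set.univ.pi fun _ : V => Set.Icc (-K) K ×ˢ Set.Icc (-K) K) :=
    isCompact_univ_pi fun _ => isCompact_Icc.prod isCompact_Icc
  refine ne_top_of_le_ne_top h2.measure_lt_top.ne (measure_mono fun p hp v _ => ?_)
  have h3 := zField_le_of_sum_le hp v
  exact ⟨abs_le.mp ((abs_fst_le_zCoord _).trans h3), abs_le.mp ((abs_snd_le_zCoord _).trans h3)⟩

/-- Bounded measurable functions supported on a set `{∑ z ≤ K}` are integrable. -/
theorem integrable_gibbs_of_bounded (β : V → V → ℝ) {f : (V → ℝ × ℝ) → ℝ} (hf : Measurable f)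
    {B K : ℝ} (hB : ∀ p, ∑ v, zField p v ≤ K → |f p| ≤ B)
    (h0 : ∀ p, K < ∑ v, zField p v → f p = 0) : Integrable f (gibbs β 0) :=
  integrable_of_bounded_of_support hf (gibbs_sum_zField_le_ne_top β K) B hB
    fun p hp => h0 p (not_le.mp hp)

theorem measurable_gibbsDensity_ofReal (β : V → V → ℝ) :
    Measurable fun p => ENNReal.ofReal (gibbsDensity β p) :=
  (continuous_gibbsDensity β).measurable.ennreal_ofReal

theorem integral_gibbs_eq_zero_of_slices (β : V → V → ℝ) {f : (V → ℝ × ℝ) → ℝ}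
    (hf : Integrable f (gibbs β 0)) (j : V)
    (h : ∀ p y, ∫ x, gibbsDensity β (Function.update p j (x, y)) *
      f (Function.update p j (x, y)) = 0) : ∫ p, f p ∂(gibbs β 0) = 0 := by
  have hlt : ∀ᵐ p : V → ℝ × ℝ, ENNReal.ofReal (gibbsDensity β p) < ∞ :=
    Filter.Eventually.of_forall fun p => ENNReal.ofReal_lt_top
  rw [gibbs_eq] at hf ⊢
  rw [integrable_withDensity_iff_integrable_smul' (measurable_gibbsDensity_ofReal β) hlt] at hf
  rw [integral_withDensity_eq_integral_toReal_smul (measurable_gibbsDensity_ofReal β) hlt]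
  simp only [ENNReal.toReal_ofReal (gibbsDensity_nonneg β _), smul_eq_mul] at hf ⊢
  exact integral_eq_zero_of_slices hf j h

/-! ### The action along a slice -/

theorem mink_sub_spin (q q' : ℝ × ℝ) :
    mink (spin q - spin q') (spin q - spin q') = -2 - 2 * mink (spin q) (spin q') := by
  have h1 := (spin_bijOn.mapsTo (Set.mem_univ q)).1
  have h2 := (spin_bijOn.mapsTo (Set.mem_univ q')).1
  simp only [mink, Prod.fst_sub, Prod.snd_sub] at *
  linarith

theorem action_zero_eq (β : V → V → ℝ) (p : V → ℝ × ℝ) :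
    action β 0 p = -(1 / 2) * ∑ k, ∑ l, β k l * (1 + mink (spin (p k)) (spin (p l))) := by
  simp only [action, mink_sub_spin, zero_mul, add_zero]
  simp only [Finset.mul_sum]
  exact Finset.sum_congr rfl fun k _ => Finset.sum_congr rfl fun l _ => by ring

theorem zCoord_mk (x y : ℝ) : zCoord (x, y) = √(√(1 + y ^ 2) ^ 2 + x ^ 2) := by
  rw [Real.sq_sqrt (by positivity)]
  unfold zCoord
  congr 1
  simp only
  ring

theorem hasDerivAt_zCoord (x y : ℝ) :
    HasDerivAt (fun x => zCoord (x, y)) (x / zCoord (x, y)) x := by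
  simp_rw [zCoord_mk]
  exact hasDerivAt_sqrt_sq_add_sq (by positivity) x

theorem hasDerivAt_action_update {β : V → V → ℝ} (hs : ∀ k l, β k l = β l k)
    (p : V → ℝ × ℝ) (j : V) (x y : ℝ) :
    HasDerivAt (fun x => action β 0 (Function.update p j (x, y)))
      (-∑ l, β j l * ((Function.update p j (x, y) l).1 -
        x / zCoord (x, y) * zCoord (Function.update p j (x, y) l))) x := by
  have h1 (k : V) : HasDerivAt (fun x => (Function.update p j (x, y) k).1)
      (if k = j then 1 else 0) x := by
    by_cases hk : k = j
    · subst hk; simpa using hasDerivAt_id' x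
    · simpa [hk] using hasDerivAt_const x (p k).1
  have h2 (k : V) : HasDerivAt (fun x => (Function.update p j (x, y) k).2) 0 x := by
    by_cases hk : k = j
    · subst hk; simpa using hasDerivAt_const x y
    · simpa [hk] using hasDerivAt_const x (p k).2
  have h3 (k : V) : HasDerivAt (fun x => zCoord (Function.update p j (x, y) k))
      (if k = j then x / zCoord (x, y) else 0) x := by
    by_cases hk : k = j
    · subst hk; simpa using hasDerivAt_zCoord x y
    · simpa [hk] using hasDerivAt_const x (zCoord (p k))
  simp only [action_zero_eq, mink, spin]
  have h4 := (HasDerivAt.fun_sum fun k (_ : k ∈ Finset.univ) => HasDerivAt.fun_sum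
    fun l (_ : l ∈ Finset.univ) => (((((h1 k).mul (h1 l)).add ((h2 k).mul (h2 l))).sub
      ((h3 k).mul (h3 l))).const_add 1).const_mul (β k l)).const_mul (-(1 / 2) : ℝ)
  refine h4.congr_deriv ?_
  simp only [mul_add, mul_sub, ite_mul, mul_ite, one_mul, mul_one, zero_mul, mul_zero, add_zero,
    Finset.sum_add_distrib, Finset.sum_sub_distrib, Finset.sum_ite_eq', Finset.mem_univ, if_true]
  rw [Finset.sum_comm]
  simp only [Finset.sum_ite_eq', Finset.sum_ite_irrel, Finset.sum_const_zero, Finset.mem_univ,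
    if_true, hs _ j]
  have h5 : ∑ l, β j l * (zCoord (Function.update p j (x, y) l) * (x / zCoord (x, y))) =
      ∑ l, β j l * (x / zCoord (x, y) * zCoord (Function.update p j (x, y) l)) :=
    Finset.sum_congr rfl fun l _ => by rw [mul_comm (zCoord _)]
  rw [h5]
  ring

end H2Model

namespace VRJP

set_option linter.unusedSectionVars false

/-! ### The stay operator as a real integral -/

variable {V : Type*} [Fintype V] [DecidableEq V]

theorem setIntegral_Ioi_comp_add (h : ℝ → ℝ) (a : ℝ) :
    ∫ τ in Set.Ioi (0 : ℝ), h (a + τ) = ∫ σ in Set.Ioi a, h σ := by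
  rw [← integral_indicator measurableSet_Ioi, ← integral_indicator measurableSet_Ioi,
    ← integral_add_left_eq_self ((Set.Ioi a).indicator h) a]
  refine integral_congr_ae (Filter.Eventually.of_forall fun τ => ?_)
  simp [Set.indicator_apply]

theorem EnvelopeBound.toReal_le {K : ℝ} {M : ℝ≥0} {n : ℕ} {f : State V → ℝ≥0∞}
    (h : EnvelopeBound K M n f) {s : State V} (hs : ∀ v, 0 ≤ s.2 v) (hK : ∑ v, s.2 v ≤ K) :
    (f s).toReal ≤ M * (K ^ n / n.factorial) := by
  have hK0 : 0 ≤ K := (Finset.sum_nonneg fun v _ => hs v).trans hK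
  refine ENNReal.toReal_le_of_le_ofReal (by positivity) ((h s hs).trans ?_)
  rw [ENNReal.ofReal_mul M.coe_nonneg, ENNReal.ofReal_coe_nnreal]
  gcongr
  exact envelope_le K n hs

theorem EnvelopeBound.eq_zero {K : ℝ} {M : ℝ≥0} {n : ℕ} {f : State V → ℝ≥0∞}
    (h : EnvelopeBound K M n f) {s : State V} (hs : ∀ v, 0 ≤ s.2 v) (hK : K < ∑ v, s.2 v) :
    f s = 0 :=
  le_antisymm ((h s hs).trans (by rw [envelope_eq_zero n hK, mul_zero])) zero_le

theorem EnvelopeBound.lt_top {K : ℝ} {M : ℝ≥0} {n : ℕ} {f : State V → ℝ≥0∞}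
    (h : EnvelopeBound K M n f) {s : State V} (hs : ∀ v, 0 ≤ s.2 v) : f s < ∞ :=
  (h s hs).trans_lt (ENNReal.mul_lt_top ENNReal.coe_lt_top
    ((envelope_le K n hs).trans_lt ENNReal.ofReal_lt_top))

variable [MeasurableSpace V] [DiscreteMeasurableSpace V]

/-- The stay operator as a real integral over the local time at the end of the stay. -/
theorem toReal_stay (β : V → V → ℝ) {K : ℝ} {M : ℝ≥0} {n : ℕ} {g : State V → ℝ≥0∞}
    (hg : Measurable g) (hb : EnvelopeBound K M n g) {s : State V} (hs : ∀ v, 0 ≤ s.2 v) :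
    (stay β g s).toReal = Real.exp (clockRate β s * s.2 s.1) *
      ∫ σ in Set.Ioi (s.2 s.1), Real.exp (-(clockRate β s * σ)) *
        (g (s.1, Function.update s.2 s.1 σ)).toReal := by
  have hgm : Measurable fun τ : ℝ => g (afterStay s s.1 τ) :=
    hg.comp (measurable_afterStay_right s s.1)
  unfold stay
  rw [← integral_toReal]
  · rw [← setIntegral_Ioi_comp_add (fun σ => Real.exp (-(clockRate β s * σ)) *
        (g (s.1, Function.update s.2 s.1 σ)).toReal), ← integral_const_mul]
    refine setIntegral_congr_fun measurableSet_Ioi fun τ _ => ?_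
    simp only [ENNReal.toReal_mul, ENNReal.toReal_ofReal (Real.exp_nonneg _), afterStay]
    rw [← mul_assoc, ← Real.exp_add]
    congr 2
    ring
  · exact (Measurable.mul (by fun_prop) hgm).aemeasurable
  · refine (ae_restrict_mem measurableSet_Ioi).mono fun τ hτ => ?_
    refine ENNReal.mul_lt_top ENNReal.ofReal_lt_top (hb.lt_top fun v => ?_)
    by_cases hv : v = s.1
    · subst hv
      simpa [afterStay] using add_nonneg (hs _) (le_of_lt hτ)
    · simpa [afterStay, hv] using hs v

end VRJP

namespace H2Model

open VRJP

set_option linter.unusedSectionVars false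

variable {V : Type*} [Fintype V] [DecidableEq V] [MeasurableSpace V] [DiscreteMeasurableSpace V]

/-! ### The Ward identity of the boost at one vertex -/

theorem zField_update (p : V → ℝ × ℝ) (j : V) (q : ℝ × ℝ) :
    zField (Function.update p j q) = Function.update (zField p) j (zCoord q) := by
  funext v
  by_cases hv : v = j
  · subst hv; simp [zField]
  · simp [zField, hv]

/-- The excess of the clock rate over the sum of the true jump rates: it is `0`, except that it
is `1` at a vertex that cannot be left. -/
noncomputable def excessRate (β : V → V → ℝ) (s : State V) : ℝ :=
  clockRate β s - ∑ l, β s.1 l * s.2 l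

/-- The integrand of the Ward identity of the boost at the vertex `j`. -/
noncomputable def wardIntegrand (β : V → V → ℝ) (g : State V → ℝ≥0∞) (i j : V)
    (p : V → ℝ × ℝ) : ℝ :=
  (p i).1 * (p j).1 * (g (j, zField p)).toReal -
    (if i = j then zField p i else 0) * (stay β g (j, zField p)).toReal -
    (p i).1 * (stay β g (j, zField p)).toReal *
      (zField p j * ∑ l, β j l * (p l).1 + excessRate β (j, zField p) * (p j).1)

theorem gibbsDensity_update (β : V → V → ℝ) (p : V → ℝ × ℝ) (j : V) (q : ℝ × ℝ) :
    gibbsDensity β (Function.update p j q) =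
      (∏ k ∈ Finset.univ.erase j, (zCoord (p k))⁻¹) * (zCoord q)⁻¹ *
        Real.exp (-action β 0 (Function.update p j q)) := by
  rw [gibbsDensity, ← Finset.mul_prod_erase _ _ (Finset.mem_univ j)]
  congr 1
  rw [Function.update_self, mul_comm]
  congr 1
  refine Finset.prod_congr rfl fun k hk => ?_
  rw [Function.update_of_ne (Finset.ne_of_mem_erase hk)]

/-- On the slice in which only `x_j` varies, the Ward integrand times the density of the Gibbs
measure is, up to a constant, formally the derivative of `x_i e^{-H}` times the stay operator. -/
theorem integral_gibbsDensity_mul_wardIntegrand {β : V → V → ℝ} (hs : ∀ k l, β k l = β l k)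
    (h0 : ∀ k, β k k = 0) {K : ℝ} {M : ℝ≥0} {g : State V → ℝ≥0∞} (hg : Measurable g)
    (hb : EnvelopeBound K M 0 g) (i j : V) (p : V → ℝ × ℝ) (y : ℝ) :
    ∫ x, gibbsDensity β (Function.update p j (x, y)) *
      wardIntegrand β g i j (Function.update p j (x, y)) = 0 := by
  set c : ℝ := ((clockRate β (j, zField p) : ℝ≥0) : ℝ) with hc
  set P : ℝ := ∏ k ∈ Finset.univ.erase j, (zCoord (p k))⁻¹ with hP
  let u : ℝ → V → ℝ × ℝ := fun x => Function.update p j (x, y)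
  let m : ℝ := √(1 + y ^ 2)
  have hm : 0 < m := Real.sqrt_pos.mpr (by positivity)
  have hr (x : ℝ) : √(m ^ 2 + x ^ 2) = zCoord (x, y) := (zCoord_mk x y).symm
  let G : ℝ → ℝ := fun σ => Real.exp (-(c * σ)) *
    (g (j, Function.update (zField p) j σ)).toReal
  -- The stay operator at `z_j = r` is `exp (c r)` times the tail integral of `G` beyond `r`, so the
  -- factor `exp (c r)` is absorbed in the weight `W`.
  let w : ℝ → ℝ := fun x => Real.exp (-action β 0 (u x) + c * zCoord (x, y))
  let W : ℝ → ℝ := fun x => (u x i).1 * w x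
  let W' : ℝ → ℝ := fun x => ((if i = j then 1 else 0) + (u x i).1 *
    (∑ l, β j l * ((u x l).1 - x / zCoord (x, y) * zCoord (u x l)) +
      c * (x / zCoord (x, y)))) * w x
  have hu : Continuous u := continuous_const.update j (by fun_prop)
  have hz : Continuous fun x : ℝ => zCoord (x, y) := continuous_zCoord.comp (by fun_prop)
  have hnn (σ : ℝ) (hσ : m ≤ σ) (v : V) : 0 ≤ Function.update (zField p) j σ v := by
    by_cases hv : v = j
    · subst hv; simpa using hm.le.trans hσ
    · simpa [hv] using (zField_pos p v).le
  have hclock (x : ℝ) : (clockRate β (j, zField (u x)) : ℝ) = c := by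
    have := clockRate_afterStay h0 (j, zField p) (zCoord (x, y) - zField p j)
    rw [hc, ← this]
    simp [u, zField_update, afterStay]
  have hstay (x : ℝ) : (stay β g (j, zField (u x))).toReal =
      Real.exp (c * zCoord (x, y)) * ∫ σ in Set.Ioi (zCoord (x, y)), G σ := by
    rw [toReal_stay β hg hb (fun v => (zField_pos _ v).le), hclock]
    simp [u, zField_update, G]
  have hγ (x : ℝ) : (g (j, zField (u x))).toReal =
      Real.exp (c * zCoord (x, y)) * G (zCoord (x, y)) := by
    simp only [G, u, zField_update, ← mul_assoc, ← Real.exp_add]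
    simp
  have hW (x : ℝ) : HasDerivAt W (W' x) x := by
    have h1 : HasDerivAt (fun x => (u x i).1) (if i = j then 1 else 0) x := by
      by_cases hk : i = j
      · subst hk; simpa [u] using hasDerivAt_id' x
      · simpa [u, hk] using hasDerivAt_const x (p i).1
    have h2 : HasDerivAt w _ x := ((hasDerivAt_action_update hs p j x y).neg.add
      ((hasDerivAt_zCoord x y).const_mul c)).exp
    refine (h1.mul h2).congr_deriv ?_
    simp only [W', w, u, Pi.add_apply, Pi.neg_apply, neg_neg]
    ring
  have hW' : Continuous W' := by
    have h1 (l : V) : Continuous fun x => u x l := (continuous_apply l).comp hu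
    have h2 (l : V) : Continuous fun x => zCoord (u x l) := continuous_zCoord.comp (h1 l)
    have h3 : Continuous fun x => action β 0 (u x) := (continuous_action β 0).comp hu
    have h4 : Continuous fun x => x / zCoord (x, y) :=
      continuous_id.div hz fun x => (zCoord_pos _).ne'
    fun_prop
  have hG : Measurable G := by
    have h1 : Measurable fun σ : ℝ => (g (j, Function.update (zField p) j σ)).toReal :=
      (hg.comp (measurable_const.prodMk (measurable_update (zField p)))).ennreal_toReal
    exact Measurable.mul (by fun_prop) h1
  have hcpos : 0 ≤ c := NNReal.coe_nonneg _
  have hGB (σ : ℝ) (hσ : m ≤ σ) : |G σ| ≤ M := by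
    have h1 : Real.exp (-(c * σ)) ≤ 1 :=
      Real.exp_le_one_iff.mpr (by nlinarith [mul_nonneg hcpos (hm.le.trans hσ)])
    have h2 : (g (j, Function.update (zField p) j σ)).toReal ≤ M := by
      by_cases h3 : ∑ v, Function.update (zField p) j σ v ≤ K
      · simpa using hb.toReal_le (s := (j, Function.update (zField p) j σ)) (hnn σ hσ) h3
      · rw [hb.eq_zero (s := (j, Function.update (zField p) j σ)) (hnn σ hσ) (not_le.mp h3)]
        simp
    rw [abs_of_nonneg (mul_nonneg (Real.exp_nonneg _) ENNReal.toReal_nonneg)]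
    calc G σ ≤ 1 * M := mul_le_mul h1 h2 ENNReal.toReal_nonneg zero_le_one
      _ = M := one_mul _
  have hGK (σ : ℝ) (hσ : m ≤ σ) (hK : K < σ) : G σ = 0 := by
    have h1 : σ ≤ ∑ v, Function.update (zField p) j σ v := by
      have := Finset.single_le_sum (fun v _ => hnn σ hσ v) (Finset.mem_univ j)
      rwa [Function.update_self] at this
    simp only [G]
    rw [hb.eq_zero (s := (j, Function.update (zField p) j σ)) (hnn σ hσ) (hK.trans_le h1)]
    simp
  have key := integral_deriv_mul_tail_sub hm hW hW' hG hGB hGK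
  simp only [hr] at key
  have hpt (x : ℝ) : gibbsDensity β (u x) * wardIntegrand β g i j (u x) =
      -P * (W' x * (∫ s in Set.Ioi (zCoord (x, y)), G s) -
        W x * G (zCoord (x, y)) * (x / zCoord (x, y))) := by
    have hz0 : zCoord (x, y) ≠ 0 := (zCoord_pos _).ne'
    have h1 : (u x j).1 = x := by simp [u]
    have h2 : zField (u x) j = zCoord (x, y) := by simp [u, zField]
    have h3 : (if i = j then zField (u x) i else 0) =
        (if i = j then 1 else 0) * zCoord (x, y) := by
      by_cases h : i = j
      · subst h; simp [h2]
      · simp [h]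
    have h4 : ∑ l, β j l * ((u x l).1 - x / zCoord (x, y) * zCoord (u x l)) =
        ∑ l, β j l * (u x l).1 - x / zCoord (x, y) * ∑ l, β j l * zField (u x) l := by
      rw [Finset.mul_sum, ← Finset.sum_sub_distrib]
      exact Finset.sum_congr rfl fun l _ => by simp only [zField]; ring
    simp only [wardIntegrand, excessRate, W, W', w, hstay, hγ, hclock, h1, h2, h3, h4,
      Real.exp_add]
    rw [gibbsDensity_update]
    simp only [← hP, u]
    field_simp
    ring
  change ∫ x, gibbsDensity β (u x) * wardIntegrand β g i j (u x) = 0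
  simp_rw [hpt]
  rw [integral_const_mul, key, mul_zero]

end H2Model

namespace VRJP

set_option linter.unusedSectionVars false

/-! ### Jump rates as real numbers -/

variable {V : Type*} [Fintype V] [DecidableEq V]

theorem coe_totalRate {β : V → V → ℝ} (hp : ∀ k l, 0 ≤ β k l) {s : State V}
    (hs : ∀ v, 0 ≤ s.2 v) : (totalRate β s : ℝ) = ∑ l, β s.1 l * s.2 l := by
  simp only [totalRate, jumpRate, NNReal.coe_sum]
  exact Finset.sum_congr rfl fun l _ => Real.coe_toNNReal _ (mul_nonneg (hp _ _) (hs l))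

theorem excessRate_eq {β : V → V → ℝ} (hp : ∀ k l, 0 ≤ β k l) {s : State V}
    (hs : ∀ v, 0 ≤ s.2 v) :
    H2Model.excessRate β s = if totalRate β s = 0 then 1 else 0 := by
  rw [H2Model.excessRate, ← coe_totalRate hp hs, clockRate]
  split_ifs with h
  · simp [h]
  · simp

/-- The rates of the jump chain are `β_{kl} ℓ_l`, except for the invisible jumps. -/
theorem clockRate_mul_jumpProb {β : V → V → ℝ} (hp : ∀ k l, 0 ≤ β k l) {s : State V}
    (hs : ∀ v, 0 ≤ s.2 v) (l : V) :
    ((clockRate β s * jumpProb β s l : ℝ≥0) : ℝ) =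
      β s.1 l * s.2 l + if l = s.1 then H2Model.excessRate β s else 0 := by
  rw [excessRate_eq hp hs]
  have h1 : (jumpRate β s l : ℝ) = β s.1 l * s.2 l :=
    Real.coe_toNNReal _ (mul_nonneg (hp _ _) (hs l))
  rw [← h1, clockRate, jumpProb]
  by_cases h : totalRate β s = 0
  · have h2 : jumpRate β s l = 0 :=
      Finset.sum_eq_zero_iff.mp h l (Finset.mem_univ l)
    simp only [h, h2, if_true]
    split_ifs <;> simp
  · simp only [h, if_false, ite_self, add_zero, NNReal.coe_inj]
    exact mul_div_cancel₀ _ h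

/-- A bound by the `n`-th envelope is also a bound by a multiple of the indicator of
`{∑ ℓ ≤ K}`. -/
theorem EnvelopeBound.weaken {K : ℝ} {M : ℝ≥0} {n : ℕ} {f : State V → ℝ≥0∞}
    (hb : EnvelopeBound K M n f) :
    EnvelopeBound K (M * (K ^ n / n.factorial).toNNReal) 0 f := by
  intro s hs
  by_cases h : ∑ v, s.2 v ≤ K
  · refine (hb s hs).trans ?_
    rw [ENNReal.coe_mul, mul_assoc]
    gcongr
    refine (envelope_le K n hs).trans ?_
    simp [envelope, h, ENNReal.ofReal]
  · rw [hb.eq_zero hs (not_le.mp h)]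
    exact zero_le

end VRJP

namespace H2Model

open VRJP

set_option linter.unusedSectionVars false

variable {V : Type*} [Fintype V] [DecidableEq V]

/-! ### Integrability against the Gibbs measure -/

theorem exists_bound_of_continuous {a : (V → ℝ × ℝ) → ℝ} (ha : Continuous a) (K : ℝ) :
    ∃ B, ∀ p, ∑ v, zField p v ≤ K → |a p| ≤ B := by
  have h2 : IsCompact (Set.univ.pi fun _ : V => Set.Icc (-K) K ×ˢ Set.Icc (-K) K) :=
    isCompact_univ_pi fun _ => isCompact_Icc.prod isCompact_Icc
  obtain ⟨B, hB⟩ := h2.exists_bound_of_continuousOn ha.continuousOn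
  refine ⟨B, fun p hp => hB p fun v _ => ?_⟩
  have h3 := zField_le_of_sum_le hp v
  exact ⟨abs_le.mp ((abs_fst_le_zCoord _).trans h3), abs_le.mp ((abs_snd_le_zCoord _).trans h3)⟩

variable [MeasurableSpace V] [DiscreteMeasurableSpace V]

theorem measurable_comp_zField {f : State V → ℝ≥0∞} (hf : Measurable f) (j : V) :
    Measurable fun p : V → ℝ × ℝ => f (j, zField p) :=
  hf.comp (measurable_const.prodMk measurable_zField)

theorem integrable_mul_toReal (β : V → V → ℝ) {a : (V → ℝ × ℝ) → ℝ} (ha : Measurable a)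
    {B K : ℝ} (hB : ∀ p, ∑ v, zField p v ≤ K → |a p| ≤ B) {M : ℝ≥0} {n : ℕ}
    {f : State V → ℝ≥0∞} (hf : Measurable f) (hb : EnvelopeBound K M n f) (j : V) :
    Integrable (fun p => a p * (f (j, zField p)).toReal) (gibbs β 0) := by
  refine integrable_gibbs_of_bounded β (B := B * (M * (K ^ n / n.factorial))) (K := K)
    (ha.mul (measurable_comp_zField hf j).ennreal_toReal) (fun p hp => ?_) fun p hp => ?_
  · rw [abs_mul, abs_of_nonneg (ENNReal.toReal_nonneg)]
    exact mul_le_mul (hB p hp) (hb.toReal_le (s := (j, zField p)) (fun v => (zField_pos p v).le) hp)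
      ENNReal.toReal_nonneg ((abs_nonneg _).trans (hB p hp))
  · rw [hb.eq_zero (s := (j, zField p)) (fun v => (zField_pos p v).le) hp]
    simp

theorem integrable_continuous_mul_toReal (β : V → V → ℝ) {a : (V → ℝ × ℝ) → ℝ}
    (ha : Continuous a) {K : ℝ} {M : ℝ≥0} {n : ℕ}
    {f : State V → ℝ≥0∞} (hf : Measurable f) (hb : EnvelopeBound K M n f) (j : V) :
    Integrable (fun p => a p * (f (j, zField p)).toReal) (gibbs β 0) := by
  obtain ⟨B, hB⟩ := exists_bound_of_continuous ha K
  exact integrable_mul_toReal β ha.measurable hB hf hb j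

theorem continuous_zField_apply (v : V) : Continuous fun p : V → ℝ × ℝ => zField p v :=
  continuous_zCoord.comp (continuous_apply v)

theorem measurable_excessRate (β : V → V → ℝ) : Measurable (excessRate (V := V) β) := by
  refine (measurable_clockRate_real β).sub (Finset.measurable_fun_sum _ fun l _ => ?_)
  have : Measurable fun s : State V => β s.1 l :=
    (Measurable.of_discrete (f := fun i => β i l)).comp measurable_fst
  fun_prop

theorem integrable_wardIntegrand {β : V → V → ℝ} (hp : ∀ k l, 0 ≤ β k l) {K : ℝ} {M : ℝ≥0}
    {g : State V → ℝ≥0∞} (hg : Measurable g) (hb : EnvelopeBound K M 0 g) (i j : V) :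
    Integrable (wardIntegrand β g i j) (gibbs β 0) := by
  have hz (v : V) := continuous_zField_apply v
  have h1 := integrable_continuous_mul_toReal β (a := fun p => (p i).1 * (p j).1)
    (by fun_prop) hg hb j
  have h2 := integrable_continuous_mul_toReal β (a := fun p => if i = j then zField p i else 0)
    (by split_ifs <;> fun_prop) (measurable_stay β hg) (hb.stay β) j
  have h3 := integrable_continuous_mul_toReal β
    (a := fun p => (p i).1 * (zField p j * ∑ l, β j l * (p l).1))
    (by fun_prop) (measurable_stay β hg) (hb.stay β) j
  have h4 : Integrable (fun p => ((p i).1 * (p j).1 * excessRate β (j, zField p)) *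
      (stay β g (j, zField p)).toReal) (gibbs β 0) := by
    obtain ⟨B, hB⟩ := exists_bound_of_continuous
      (a := fun p : V → ℝ × ℝ => (p i).1 * (p j).1) (by fun_prop) K
    refine integrable_mul_toReal β (B := B) ?_ (fun p h => ?_) (measurable_stay β hg)
      (hb.stay β) j
    · exact Measurable.mul (by fun_prop)
        ((measurable_excessRate β).comp (measurable_const.prodMk measurable_zField))
    · rw [abs_mul, excessRate_eq hp (fun v => (zField_pos p v).le)]
      have h5 := hB p h
      split_ifs
      · simpa using h5
      · simpa using (abs_nonneg _).trans h5
  convert (h1.sub h2).sub (h3.add h4) using 1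
  funext p
  simp only [wardIntegrand, Pi.sub_apply, Pi.add_apply]
  ring

/-- The Ward identity of the boost `z ∂_x` at the vertex `j`, tested against the product of `x_i`
with the stay operator. -/
theorem integral_wardIntegrand {β : V → V → ℝ} (hs : ∀ k l, β k l = β l k)
    (h0 : ∀ k, β k k = 0) (hp : ∀ k l, 0 ≤ β k l) {K : ℝ} {M : ℝ≥0}
    {g : State V → ℝ≥0∞} (hg : Measurable g) (hb : EnvelopeBound K M 0 g) (i j : V) :
    ∫ p, wardIntegrand β g i j p ∂(gibbs β 0) = 0 :=
  integral_gibbs_eq_zero_of_slices β (integrable_wardIntegrand hp hg hb i j) j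
    fun p y => integral_gibbsDensity_mul_wardIntegrand hs h0 hg hb i j p y

/-! ### The Ward identity summed over the vertices -/

/-- The expectation of `x_i ∑_j x_j f(j, z)`. -/
noncomputable def spinForm (β : V → V → ℝ) (i : V) (f : State V → ℝ≥0∞) : ℝ :=
  ∫ p, ∑ j, (p i).1 * (p j).1 * (f (j, zField p)).toReal ∂(gibbs β 0)

/-- In the sum over the vertices, the symmetry of `β` turns the variation of the action into the
jump operator. -/
theorem sum_wardIntegrand {β : V → V → ℝ} (hs : ∀ k l, β k l = β l k)
    (hp : ∀ k l, 0 ≤ β k l) {K : ℝ} {M : ℝ≥0}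
    {g : State V → ℝ≥0∞} (hb : EnvelopeBound K M 0 g) (i : V) (p : V → ℝ × ℝ) :
    ∑ j, wardIntegrand β g i j p = ∑ j, (p i).1 * (p j).1 * (g (j, zField p)).toReal -
      zField p i * (stay β g (i, zField p)).toReal -
      ∑ j, (p i).1 * (p j).1 * (jumpOp β (stay β g) (j, zField p)).toReal := by
  have hz (v : V) : 0 ≤ zField p v := (zField_pos p v).le
  have h1 (j : V) : (jumpOp β (stay β g) (j, zField p)).toReal = ∑ l,
      (β j l * zField p l + if l = j then excessRate β (j, zField p) else 0) *
        (stay β g (l, zField p)).toReal := by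
    unfold jumpOp
    rw [ENNReal.toReal_sum fun l _ => ENNReal.mul_ne_top ENNReal.coe_ne_top
      ((hb.stay β).lt_top (s := (l, zField p)) hz).ne]
    refine Finset.sum_congr rfl fun l _ => ?_
    rw [ENNReal.toReal_mul, ENNReal.coe_toReal, clockRate_mul_jumpProb hp hz]
  have h2 : ∑ j, (p j).1 * (jumpOp β (stay β g) (j, zField p)).toReal =
      ∑ j, (stay β g (j, zField p)).toReal *
        (zField p j * ∑ l, β j l * (p l).1 + excessRate β (j, zField p) * (p j).1) := by
    simp only [h1, add_mul, Finset.sum_add_distrib, ite_mul, zero_mul, Finset.sum_ite_eq',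
      Finset.mem_univ, if_true, mul_add]
    congr 1
    · simp only [Finset.mul_sum]
      rw [Finset.sum_comm]
      refine Finset.sum_congr rfl fun j _ => Finset.sum_congr rfl fun l _ => ?_
      rw [hs l j]
      ring
    · exact Finset.sum_congr rfl fun j _ => by ring
  simp only [wardIntegrand, Finset.sum_sub_distrib, ite_mul, zero_mul, Finset.sum_ite_eq,
    Finset.mem_univ, if_true]
  congr 1
  simp only [mul_assoc, ← Finset.mul_sum]
  rw [h2]

theorem integrable_spinForm (β : V → V → ℝ) (i : V) {K : ℝ} {M : ℝ≥0} {n : ℕ}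
    {f : State V → ℝ≥0∞} (hf : Measurable f) (hb : EnvelopeBound K M n f) :
    Integrable (fun p => ∑ j, (p i).1 * (p j).1 * (f (j, zField p)).toReal) (gibbs β 0) :=
  integrable_finsetSum _ fun j _ => integrable_continuous_mul_toReal β
    (a := fun p => (p i).1 * (p j).1) (by fun_prop) hf hb j

theorem spinForm_eq_add {β : V → V → ℝ} (hs : ∀ k l, β k l = β l k)
    (h0 : ∀ k, β k k = 0) (hp : ∀ k l, 0 ≤ β k l) {K : ℝ} {M : ℝ≥0}
    {g : State V → ℝ≥0∞} (hg : Measurable g) (hb : EnvelopeBound K M 0 g) (i : V) :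
    spinForm β i g = ∫ p, zField p i * (stay β g (i, zField p)).toReal ∂(gibbs β 0) +
      spinForm β i (jumpOp β (stay β g)) := by
  have h1 : ∫ p, ∑ j, wardIntegrand β g i j p ∂(gibbs β 0) = 0 := by
    rw [integral_finsetSum _ fun j _ => integrable_wardIntegrand hp hg hb i j]
    exact Finset.sum_eq_zero fun j _ => integral_wardIntegrand hs h0 hp hg hb i j
  have i1 := integrable_spinForm β i hg hb
  have i2 := integrable_continuous_mul_toReal β (continuous_zField_apply i)
    (measurable_stay β hg) (hb.stay β) i
  have i3 := integrable_spinForm β i (measurable_jumpOp β (measurable_stay β hg))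
    ((hb.stay β).jumpOp β)
  simp only [sum_wardIntegrand hs hp hb i] at h1
  have h2 := integral_sub (i1.sub i2) i3
  simp only [Pi.sub_apply] at h2
  rw [h2, integral_sub i1 i2] at h1
  unfold spinForm
  linarith

theorem spinForm_eq_sum_add {β : V → V → ℝ} (hs : ∀ k l, β k l = β l k)
    (h0 : ∀ k, β k k = 0) (hp : ∀ k l, 0 ≤ β k l) {K : ℝ} {M : ℝ≥0}
    {g : State V → ℝ≥0∞} (hg : Measurable g) (hb : EnvelopeBound K M 0 g) (i : V) (N : ℕ) :
    spinForm β i g = ∑ n ∈ Finset.range N, ∫ p, zField p i *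
        (stay β ((fun f => jumpOp β (stay β f))^[n] g) (i, zField p)).toReal ∂(gibbs β 0) +
      spinForm β i ((fun f => jumpOp β (stay β f))^[N] g) := by
  induction N with
  | zero => simp
  | succ N ih =>
    rw [ih, Finset.sum_range_succ, add_assoc]
    congr 1
    rw [Function.iterate_succ_apply']
    exact spinForm_eq_add hs h0 hp (measurable_iterate β N hg)
      (hb.iterate β N).weaken i

/-- The remainder after `N` jumps vanishes as `N → ∞`: within a total local time of `K`, the
weight of `N` jumps is at most of order `(C K) ^ N / N!`. -/
theorem tendsto_spinForm_iterate (β : V → V → ℝ) {K : ℝ} {M : ℝ≥0}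
    {g : State V → ℝ≥0∞} (hb : EnvelopeBound K M 0 g) (i : V) :
    Filter.Tendsto (fun N => spinForm β i ((fun f => jumpOp β (stay β f))^[N] g))
      Filter.atTop (nhds 0) := by
  set S : Set (V → ℝ × ℝ) := {p | ∑ v, zField p v ≤ K} with hS
  have hSm : MeasurableSet S :=
    measurableSet_le (Finset.measurable_fun_sum _ fun v _ =>
      (measurable_pi_apply v).comp measurable_zField) measurable_const
  obtain ⟨B, hB⟩ := exists_bound_of_continuous (V := V)
    (a := fun p => ∑ j, |(p i).1 * (p j).1|) (by fun_prop) K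
  let b : ℕ → ℝ := fun N => (rateBound β K ^ N * M : ℝ≥0) * (K ^ N / N.factorial)
  have hb0 : Filter.Tendsto b Filter.atTop (nhds 0) := by
    have h := (FloorSemiring.tendsto_pow_div_factorial_atTop
      ((rateBound β K : ℝ) * K)).const_mul (M : ℝ)
    rw [mul_zero] at h
    refine h.congr fun N => ?_
    simp only [b]
    push_cast
    rw [mul_pow]
    ring
  have hint : Integrable (S.indicator fun _ => B) (gibbs β 0) :=
    (integrableOn_const (gibbs_sum_zField_le_ne_top β K)).integrable_indicator hSm
  have hlim := hb0.mul_const (∫ p, S.indicator (fun _ => B) p ∂(gibbs β 0))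
  rw [zero_mul] at hlim
  refine squeeze_zero_norm (fun N => ?_) hlim
  rw [← integral_const_mul]
  refine norm_integral_le_of_norm_le (hint.const_mul _) (Filter.Eventually.of_forall fun p => ?_)
  have hz (v : V) : 0 ≤ zField p v := (zField_pos p v).le
  by_cases hpS : p ∈ S
  · rw [Set.indicator_of_mem hpS]
    have h1 (j : V) := (hb.iterate β N).toReal_le (s := (j, zField p)) hz hpS
    have hbN : 0 ≤ b N := ENNReal.toReal_nonneg.trans (h1 i)
    calc ‖∑ j, (p i).1 * (p j).1 *
          (((fun f => jumpOp β (stay β f))^[N] g) (j, zField p)).toReal‖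
        ≤ ∑ j, |(p i).1 * (p j).1| * b N := by
          refine norm_sum_le_of_le _ fun j _ => ?_
          rw [Real.norm_eq_abs, abs_mul, abs_of_nonneg (ENNReal.toReal_nonneg)]
          exact mul_le_mul_of_nonneg_left (h1 j) (abs_nonneg _)
      _ = b N * ∑ j, |(p i).1 * (p j).1| := by rw [← Finset.sum_mul, mul_comm]
      _ ≤ b N * B := mul_le_mul_of_nonneg_left ((le_abs_self _).trans (hB p hpS)) hbN
  · rw [Set.indicator_of_notMem hpS]
    have h1 (j : V) := (hb.iterate β N).eq_zero (s := (j, zField p)) hz (not_le.mp hpS)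
    simp [h1]

theorem hasSum_spinForm {β : V → V → ℝ} (hs : ∀ k l, β k l = β l k)
    (h0 : ∀ k, β k k = 0) (hp : ∀ k l, 0 ≤ β k l) {K : ℝ} {M : ℝ≥0}
    {g : State V → ℝ≥0∞} (hg : Measurable g) (hb : EnvelopeBound K M 0 g) (i : V) :
    HasSum (fun n => ∫ p, zField p i *
        (stay β ((fun f => jumpOp β (stay β f))^[n] g) (i, zField p)).toReal ∂(gibbs β 0))
      (spinForm β i g) := by
  rw [hasSum_iff_tendsto_nat_of_nonneg fun n => integral_nonneg fun p =>
    mul_nonneg (zField_pos p i).le ENNReal.toReal_nonneg]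
  have h1 := (tendsto_spinForm_iterate β hb i).const_sub (spinForm β i g)
  rw [sub_zero] at h1
  refine h1.congr fun N => ?_
  rw [spinForm_eq_sum_add hs h0 hp hg hb i N]
  simp

/-- Although `x_i x_j` changes sign, the form is nonnegative on nonnegative functions. -/
theorem spinForm_nonneg {β : V → V → ℝ} (hs : ∀ k l, β k l = β l k)
    (h0 : ∀ k, β k k = 0) (hp : ∀ k l, 0 ≤ β k l) {K : ℝ} {M : ℝ≥0}
    {g : State V → ℝ≥0∞} (hg : Measurable g) (hb : EnvelopeBound K M 0 g) (i : V) :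
    0 ≤ spinForm β i g :=
  (hasSum_spinForm hs h0 hp hg hb i).nonneg fun _ => integral_nonneg fun p =>
    mul_nonneg (zField_pos p i).le ENNReal.toReal_nonneg

/-- The isomorphism for functions of bounded support: the Ward identity, iterated along the
jumps. -/
theorem lintegral_zField_mul_potential {β : V → V → ℝ} (hs : ∀ k l, β k l = β l k)
    (h0 : ∀ k, β k k = 0) (hp : ∀ k l, 0 ≤ β k l) {K : ℝ} {M : ℝ≥0}
    {g : State V → ℝ≥0∞} (hg : Measurable g) (hb : EnvelopeBound K M 0 g) (i : V) :
    ∫⁻ p, ENNReal.ofReal (zField p i) * potential β g (i, zField p) ∂(gibbs β 0) =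
      ENNReal.ofReal (spinForm β i g) := by
  let G : ℕ → State V → ℝ≥0∞ := fun n => stay β ((fun f => jumpOp β (stay β f))^[n] g)
  have hGm (n : ℕ) : Measurable (G n) := measurable_stay β (measurable_iterate β n hg)
  let a : ℕ → ℝ := fun n => ∫ p, zField p i * (G n (i, zField p)).toReal ∂(gibbs β 0)
  have ha (n : ℕ) : 0 ≤ a n :=
    integral_nonneg fun p => mul_nonneg (zField_pos p i).le ENNReal.toReal_nonneg
  have hsum : HasSum a (spinForm β i g) := hasSum_spinForm hs h0 hp hg hb i
  have hterm (n : ℕ) : ∫⁻ p, ENNReal.ofReal (zField p i) * G n (i, zField p) ∂(gibbs β 0) =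
      ENNReal.ofReal (a n) := by
    have hb' := (hb.iterate β n).stay β
    rw [ofReal_integral_eq_lintegral_ofReal (integrable_continuous_mul_toReal β
      (continuous_zField_apply i) (hGm n) hb' i) (Filter.Eventually.of_forall fun p =>
        mul_nonneg (zField_pos p i).le ENNReal.toReal_nonneg)]
    refine lintegral_congr fun p => ?_
    rw [ENNReal.ofReal_mul (zField_pos p i).le, ENNReal.ofReal_toReal
      (hb'.lt_top (s := (i, zField p)) fun v => (zField_pos p v).le).ne]
  have h1 (p : V → ℝ × ℝ) : ENNReal.ofReal (zField p i) * potential β g (i, zField p) =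
      ∑' n, ENNReal.ofReal (zField p i) * G n (i, zField p) := by
    rw [ENNReal.tsum_mul_left]
    rfl
  simp_rw [h1]
  rw [lintegral_tsum (f := fun n p => ENNReal.ofReal (zField p i) * G n (i, zField p))
    fun n => (Measurable.mul
    (continuous_zField_apply i).measurable.ennreal_ofReal
    (measurable_comp_zField (hGm n) i)).aemeasurable]
  simp_rw [hterm]
  rw [← ENNReal.ofReal_tsum_of_nonneg ha hsum.summable, hsum.tsum_eq]

end H2Model

namespace H2Model

open VRJP

set_option linter.unusedSectionVars false

variable {V : Type*} [Fintype V] [DecidableEq V] [MeasurableSpace V] [DiscreteMeasurableSpace V]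

/-! ### From bounded support to integrable functions -/

/-- The function `1_{X = j} F(L)` of the state `(X, L)`, for nonnegative `F`. -/
noncomputable def restrictAt (F : (V → ℝ) → ℝ) (j : V) (s : State V) : ℝ≥0∞ :=
  if s.1 = j then ENNReal.ofReal (F s.2) else 0

theorem measurable_restrictAt {F : (V → ℝ) → ℝ} (hF : Measurable F) (j : V) :
    Measurable (restrictAt F j) :=
  Measurable.ite ((measurableSet_singleton j).preimage measurable_fst)
    (hF.comp measurable_snd).ennreal_ofReal measurable_const

/-- The truncation of `F` to values at most `k` and to local times of sum at most `k`. -/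
noncomputable def truncate (F : (V → ℝ) → ℝ) (k : ℕ) (ℓ : V → ℝ) : ℝ :=
  if ∑ v, ℓ v ≤ k then min (F ℓ) k else 0

theorem measurable_truncate {F : (V → ℝ) → ℝ} (hF : Measurable F) (k : ℕ) :
    Measurable (truncate F k) :=
  Measurable.ite (measurableSet_le (by fun_prop) measurable_const) (hF.min measurable_const)
    measurable_const

theorem truncate_nonneg {F : (V → ℝ) → ℝ} (h0 : ∀ ℓ, 0 ≤ F ℓ) (k : ℕ) (ℓ : V → ℝ) :
    0 ≤ truncate F k ℓ := by
  unfold truncate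
  split_ifs
  · exact le_min (h0 ℓ) k.cast_nonneg
  · exact le_rfl

theorem truncate_le {F : (V → ℝ) → ℝ} (h0 : ∀ ℓ, 0 ≤ F ℓ) (k : ℕ) (ℓ : V → ℝ) :
    truncate F k ℓ ≤ F ℓ := by
  unfold truncate
  split_ifs
  · exact min_le_left _ _
  · exact h0 ℓ

theorem truncate_mono {F : (V → ℝ) → ℝ} (h0 : ∀ ℓ, 0 ≤ F ℓ) (ℓ : V → ℝ) :
    Monotone fun k => truncate F k ℓ := by
  intro k l hkl
  have h1 : (k : ℝ) ≤ l := by exact_mod_cast hkl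
  by_cases h : ∑ v, ℓ v ≤ k
  · simp only [truncate, h, h.trans h1, if_true]
    exact min_le_min le_rfl h1
  · have h2 := truncate_nonneg h0 l ℓ
    simpa [truncate, h] using h2

theorem tendsto_truncate (F : (V → ℝ) → ℝ) (ℓ : V → ℝ) :
    Filter.Tendsto (fun k => truncate F k ℓ) Filter.atTop (nhds (F ℓ)) := by
  obtain ⟨n, hn⟩ := exists_nat_ge (max (∑ v, ℓ v) (F ℓ))
  refine tendsto_const_nhds.congr' ?_
  filter_upwards [Filter.eventually_ge_atTop n] with k hk
  have h1 : (n : ℝ) ≤ k := by exact_mod_cast hk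
  rw [truncate, if_pos ((le_max_left _ _).trans (hn.trans h1)),
    min_eq_left ((le_max_right _ _).trans (hn.trans h1))]

theorem envelopeBound_restrictAt_truncate (F : (V → ℝ) → ℝ) (j : V) (k : ℕ) :
    EnvelopeBound (k : ℝ) (k : ℝ≥0) 0 (restrictAt (truncate F k) j) := by
  intro s _
  unfold restrictAt truncate envelope
  split_ifs
  · simp
  · simp
  · exact zero_le
  · exact zero_le

/-- The potential is continuous along the truncations, by monotone convergence along the paths. -/
theorem potential_restrictAt_eq_iSup {β : V → V → ℝ} (hd : ∀ k, β k k = 0) {F : (V → ℝ) → ℝ}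
    (hF : Measurable F) (h0 : ∀ ℓ, 0 ≤ F ℓ) (i j : V) {ℓ : V → ℝ} (hℓ : ∀ v, 0 ≤ ℓ v) :
    (Monotone fun k => potential β (restrictAt (truncate F k) j) (i, ℓ)) ∧
    potential β (restrictAt F j) (i, ℓ) =
      ⨆ k, potential β (restrictAt (truncate F k) j) (i, ℓ) := by
  have hm (k : ℕ) := measurable_restrictAt (measurable_truncate hF k) j
  have hmono (s : State V) : Monotone fun k => restrictAt (truncate F k) j s := by
    intro k l hkl
    simp only [restrictAt]
    split_ifs
    · exact ENNReal.ofReal_le_ofReal (truncate_mono h0 s.2 hkl)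
    · exact le_rfl
  have hsup (s : State V) : restrictAt F j s = ⨆ k, restrictAt (truncate F k) j s := by
    refine (iSup_eq_of_tendsto (hmono s) ?_).symm
    simp only [restrictAt]
    split_ifs
    · exact ENNReal.tendsto_ofReal (tendsto_truncate F s.2)
    · exact tendsto_const_nhds
  simp_rw [← lintegral_lintegral_stateAt hd i hℓ (hm _),
    ← lintegral_lintegral_stateAt hd i hℓ (measurable_restrictAt hF j), hsup]
  refine ⟨fun k l hkl => lintegral_mono fun ω => lintegral_mono fun t => hmono _ hkl, ?_⟩
  rw [← lintegral_iSup]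
  · refine lintegral_congr fun ω => ?_
    rw [lintegral_iSup]
    · exact fun k => (hm k).comp (measurable_stateAt.comp measurable_prodMk_left)
    · exact fun k l hkl t => hmono _ hkl
  · exact fun k => ((hm k).comp measurable_stateAt).lintegral_prod_right'
  · exact fun k l hkl ω => lintegral_mono fun t => hmono _ hkl

theorem spinForm_restrictAt (β : V → V → ℝ) {F : (V → ℝ) → ℝ} (h0 : ∀ ℓ, 0 ≤ F ℓ) (i j : V) :
    spinForm β i (restrictAt F j) =
      ∫ p, (p i).1 * (p j).1 * F (zField p) ∂(gibbs β 0) := by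
  unfold spinForm restrictAt
  refine integral_congr_ae (Filter.Eventually.of_forall fun p => ?_)
  simp only
  rw [Finset.sum_eq_single j (fun l _ hl => by simp [hl]) (by simp)]
  simp [h0]

/-- The isomorphism for nonnegative functions, as an identity of extended nonnegative numbers. -/
theorem lintegral_zField_mul_potential_of_nonneg {β : V → V → ℝ} (hs : ∀ k l, β k l = β l k)
    (hd : ∀ k, β k k = 0) (hp : ∀ k l, 0 ≤ β k l) {F : (V → ℝ) → ℝ}
    (hF : Measurable F) (h0 : ∀ ℓ, 0 ≤ F ℓ) (i j : V)
    (hint : Integrable (fun p : V → ℝ × ℝ => (p i).1 * (p j).1 * F (zField p)) (gibbs β 0)) :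
    0 ≤ ∫ p, (p i).1 * (p j).1 * F (zField p) ∂(gibbs β 0) ∧
    ∫⁻ p, ENNReal.ofReal (zField p i) * potential β (restrictAt F j) (i, zField p) ∂(gibbs β 0) =
      ENNReal.ofReal (∫ p, (p i).1 * (p j).1 * F (zField p) ∂(gibbs β 0)) := by
  have hz (p : V → ℝ × ℝ) (v : V) : 0 ≤ zField p v := (zField_pos p v).le
  have hm (k : ℕ) := measurable_restrictAt (measurable_truncate hF k) j
  have hlim : Filter.Tendsto (fun k => spinForm β i (restrictAt (truncate F k) j)) Filter.atTop
      (nhds (∫ p, (p i).1 * (p j).1 * F (zField p) ∂(gibbs β 0))) := by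
    simp_rw [fun k => spinForm_restrictAt β (truncate_nonneg h0 k) i j]
    refine tendsto_integral_of_dominated_convergence _ (fun k => ?_) hint.norm (fun k => ?_) ?_
    · exact (Measurable.mul (by fun_prop)
        ((measurable_truncate hF k).comp measurable_zField)).aestronglyMeasurable
    · refine Filter.Eventually.of_forall fun p => ?_
      rw [norm_mul, norm_mul _ (F _), Real.norm_of_nonneg (truncate_nonneg h0 k _),
        Real.norm_of_nonneg (h0 _)]
      exact mul_le_mul_of_nonneg_left (truncate_le h0 k _) (norm_nonneg _)
    · exact Filter.Eventually.of_forall fun p => (tendsto_truncate F _).const_mul _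
  refine ⟨ge_of_tendsto' hlim fun k => spinForm_nonneg hs hd hp (hm k)
    (envelopeBound_restrictAt_truncate F j k) i, ?_⟩
  have h1 (p : V → ℝ × ℝ) := potential_restrictAt_eq_iSup hd hF h0 i j (hz p)
  refine tendsto_nhds_unique ?_ (ENNReal.tendsto_ofReal hlim)
  simp_rw [← lintegral_zField_mul_potential hs hd hp (hm _)
    (envelopeBound_restrictAt_truncate F j _) i]
  refine lintegral_tendsto_of_tendsto_of_monotone (fun k => ?_)
    (Filter.Eventually.of_forall fun p k l hkl => ?_) (Filter.Eventually.of_forall fun p => ?_)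
  · exact (Measurable.mul (continuous_zField_apply i).measurable.ennreal_ofReal
      (measurable_comp_zField (measurable_potential β (hm k)) i)).aemeasurable
  · exact mul_le_mul_right ((h1 p).1 hkl) _
  · rw [(h1 p).2]
    exact ENNReal.Tendsto.const_mul (tendsto_atTop_iSup (h1 p).1) (Or.inr ENNReal.ofReal_ne_top)

theorem ite_pos_eq_toReal_sub (F : (V → ℝ) → ℝ) (j : V) (ω : Path V) (t : ℝ) :
    (if pos ω t = j then F (localTime ω t) else 0) =
      (restrictAt (fun ℓ => max (F ℓ) 0) j (stateAt ω t)).toReal -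
        (restrictAt (fun ℓ => max (-F ℓ) 0) j (stateAt ω t)).toReal := by
  change _ = (if pos ω t = j then ENNReal.ofReal (max (F (localTime ω t)) 0) else 0).toReal -
    (if pos ω t = j then ENNReal.ofReal (max (-F (localTime ω t)) 0) else 0).toReal
  split_ifs
  · simp only [ENNReal.toReal_ofReal (le_max_right _ _)]
    rcases le_total 0 (F (localTime ω t)) with h | h
    · simp [h]
    · simp [h]
  · simp

/-- Integrability and value of the expected occupation integral of a signed function, in terms of
the potentials of its positive and negative parts. -/
theorem integrable_occupation {β : V → V → ℝ} (hd : ∀ k, β k k = 0) {F : (V → ℝ) → ℝ}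
    (hF : Measurable F) (i j : V) {ℓ : V → ℝ} (hℓ : ∀ v, 0 ≤ ℓ v)
    (h1 : potential β (restrictAt (fun ℓ => max (F ℓ) 0) j) (i, ℓ) ≠ ∞)
    (h2 : potential β (restrictAt (fun ℓ => max (-F ℓ) 0) j) (i, ℓ) ≠ ∞) :
    Integrable (fun q : Path V × ℝ => if pos q.1 q.2 = j then F (localTime q.1 q.2) else 0)
      ((law β i ℓ).prod (volume.restrict (Set.Ioi 0))) ∧
    ∫ t in Set.Ioi (0 : ℝ), ∫ ω, (if pos ω t = j then F (localTime ω t) else 0) ∂(law β i ℓ) =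
      (potential β (restrictAt (fun ℓ => max (F ℓ) 0) j) (i, ℓ)).toReal -
        (potential β (restrictAt (fun ℓ => max (-F ℓ) 0) j) (i, ℓ)).toReal := by
  have key {F : (V → ℝ) → ℝ} (hF : Measurable F)
      (h : potential β (restrictAt F j) (i, ℓ) ≠ ∞) :
      Integrable (fun q : Path V × ℝ => (restrictAt F j (stateAt q.1 q.2)).toReal)
        ((law β i ℓ).prod (volume.restrict (Set.Ioi 0))) ∧
      ∫ q, (restrictAt F j (stateAt q.1 q.2)).toReal
        ∂((law β i ℓ).prod (volume.restrict (Set.Ioi 0))) =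
        (potential β (restrictAt F j) (i, ℓ)).toReal := by
    have hm : Measurable fun q : Path V × ℝ => restrictAt F j (stateAt q.1 q.2) :=
      (measurable_restrictAt hF j).comp measurable_stateAt
    have h3 : ∫⁻ q, restrictAt F j (stateAt q.1 q.2)
        ∂((law β i ℓ).prod (volume.restrict (Set.Ioi 0))) =
        potential β (restrictAt F j) (i, ℓ) := by
      rw [lintegral_prod _ hm.aemeasurable]
      exact lintegral_lintegral_stateAt hd i hℓ (measurable_restrictAt hF j)
    rw [← h3] at h ⊢
    exact ⟨integrable_toReal_of_lintegral_ne_top hm.aemeasurable h,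
      integral_toReal hm.aemeasurable (ae_lt_top hm h)⟩
  obtain ⟨a1, a2⟩ := key (hF.max measurable_const) h1
  obtain ⟨b1, b2⟩ := key (F := fun ℓ => max (-F ℓ) 0) (hF.neg.max measurable_const) h2
  have hI : Integrable (fun q : Path V × ℝ =>
      if pos q.1 q.2 = j then F (localTime q.1 q.2) else 0)
      ((law β i ℓ).prod (volume.restrict (Set.Ioi 0))) := by
    simp_rw [ite_pos_eq_toReal_sub F j]
    exact a1.sub b1
  refine ⟨hI, ?_⟩
  rw [← integral_prod_symm _ hI]
  simp_rw [ite_pos_eq_toReal_sub F j]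
  rw [integral_sub a1 b1, a2, b2]

end H2Model

open H2Model VRJP

theorem mainTheorem1 {V : Type*} [Fintype V] [DecidableEq V] [MeasurableSpace V]
    [DiscreteMeasurableSpace V] (G : SimpleGraph V) (β : V → V → ℝ)
    (β_symm : ∀ k l, β k l = β l k)
    (β_pos : ∀ k l, G.Adj k l → 0 < β k l)
    (β_zero : ∀ k l, ¬ G.Adj k l → β k l = 0)
    (i j : V) (F : (V → ℝ) → ℝ) (F_meas : Measurable F)
    (F_decay : Integrable (fun p : V → ℝ × ℝ => (p i).1 * (p j).1 * F (H2Model.zField p))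
      (H2Model.gibbs β 0)) :
    (∀ᵐ p ∂(H2Model.gibbs β 0), ∀ᵐ t ∂(volume.restrict (Set.Ioi (0 : ℝ))),
      Integrable (fun ω => if VRJP.pos ω t = j then F (VRJP.localTime ω t) else 0)
        (VRJP.law β i (H2Model.zField p))) ∧
    (∀ᵐ p ∂(H2Model.gibbs β 0),
      IntegrableOn (fun t : ℝ =>
        ∫ ω, (if VRJP.pos ω t = j then F (VRJP.localTime ω t) else 0)
          ∂(VRJP.law β i (H2Model.zField p))) (Set.Ioi 0)) ∧
    Integrable (fun p : V → ℝ × ℝ => H2Model.zField p i *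
      ∫ t in Set.Ioi (0 : ℝ),
        ∫ ω, (if VRJP.pos ω t = j then F (VRJP.localTime ω t) else 0)
          ∂(VRJP.law β i (H2Model.zField p))) (H2Model.gibbs β 0) ∧
    H2Model.expect β 0 (fun p => (p i).1 * (p j).1 * F (H2Model.zField p)) =
      H2Model.expect β 0 (fun p => H2Model.zField p i *
        ∫ t in Set.Ioi (0 : ℝ),
          ∫ ω, (if VRJP.pos ω t = j then F (VRJP.localTime ω t) else 0)
            ∂(VRJP.law β i (H2Model.zField p))) := by
  have hd (k : V) : β k k = 0 := β_zero k k (G.irrefl)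
  have hp (k l : V) : 0 ≤ β k l := by
    by_cases h : G.Adj k l
    · exact (β_pos k l h).le
    · exact (β_zero k l h).ge
  have hz (p : V → ℝ × ℝ) (v : V) : 0 ≤ zField p v := (zField_pos p v).le
  -- A nonnegative `F' ≤ |F|`; this is used for the positive and the negative part of `F`.
  have key {F' : (V → ℝ) → ℝ} (hF' : Measurable F') (h0 : ∀ ℓ, 0 ≤ F' ℓ)
      (hle : ∀ ℓ, F' ℓ ≤ |F ℓ|) :
      Integrable (fun p : V → ℝ × ℝ => (p i).1 * (p j).1 * F' (zField p)) (gibbs β 0) ∧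
      (∀ᵐ p ∂(gibbs β 0), potential β (restrictAt F' j) (i, zField p) ≠ ∞) ∧
      Integrable (fun p => zField p i * (potential β (restrictAt F' j) (i, zField p)).toReal)
        (gibbs β 0) ∧
      ∫ p, zField p i * (potential β (restrictAt F' j) (i, zField p)).toReal ∂(gibbs β 0) =
        ∫ p, (p i).1 * (p j).1 * F' (zField p) ∂(gibbs β 0) := by
    have hint : Integrable (fun p : V → ℝ × ℝ => (p i).1 * (p j).1 * F' (zField p))
        (gibbs β 0) := by
      refine F_decay.mono ((Measurable.mul (by fun_prop)
        (hF'.comp measurable_zField)).aestronglyMeasurable)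
        (Filter.Eventually.of_forall fun p => ?_)
      rw [norm_mul, norm_mul _ (F _), Real.norm_of_nonneg (h0 _)]
      exact mul_le_mul_of_nonneg_left (hle _) (norm_nonneg _)
    obtain ⟨h1, h2⟩ := lintegral_zField_mul_potential_of_nonneg β_symm hd hp hF' h0 i j hint
    have hm : Measurable fun p : V → ℝ × ℝ =>
        ENNReal.ofReal (zField p i) * potential β (restrictAt F' j) (i, zField p) :=
      Measurable.mul (continuous_zField_apply i).measurable.ennreal_ofReal
        (measurable_comp_zField (measurable_potential β (measurable_restrictAt hF' j)) i)
    have hfin : ∫⁻ p, ENNReal.ofReal (zField p i) * potential β (restrictAt F' j) (i, zField p)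
        ∂(gibbs β 0) ≠ ∞ := by rw [h2]; exact ENNReal.ofReal_ne_top
    have hlt := ae_lt_top hm hfin
    have hr (p : V → ℝ × ℝ) :
        (ENNReal.ofReal (zField p i) * potential β (restrictAt F' j) (i, zField p)).toReal =
        zField p i * (potential β (restrictAt F' j) (i, zField p)).toReal := by
      rw [ENNReal.toReal_mul, ENNReal.toReal_ofReal (hz p i)]
    refine ⟨hint, ?_, ?_, ?_⟩
    · filter_upwards [hlt] with p h hpot
      rw [hpot, ENNReal.mul_top (by simpa using zField_pos p i)] at h
      exact h.ne rfl
    · simpa only [hr] using integrable_toReal_of_lintegral_ne_top hm.aemeasurable hfin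
    · simp_rw [← hr]
      rw [integral_toReal hm.aemeasurable hlt, h2, ENNReal.toReal_ofReal h1]
  obtain ⟨a1, a2, a3, a4⟩ := key (F' := fun ℓ => max (F ℓ) 0) (F_meas.max measurable_const)
    (fun ℓ => le_max_right _ _) (fun ℓ => max_le (le_abs_self _) (abs_nonneg _))
  obtain ⟨b1, b2, b3, b4⟩ := key (F' := fun ℓ => max (-F ℓ) 0) (F_meas.neg.max measurable_const)
    (fun ℓ => le_max_right _ _) (fun ℓ => max_le (neg_le_abs _) (abs_nonneg _))
  have hocc := (a2.and b2).mono fun p h =>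
    integrable_occupation hd F_meas i j (hz p) h.1 h.2
  have hval : (fun p : V → ℝ × ℝ => zField p i *
      ((potential β (restrictAt (fun ℓ => max (F ℓ) 0) j) (i, zField p)).toReal -
        (potential β (restrictAt (fun ℓ => max (-F ℓ) 0) j) (i, zField p)).toReal))
      =ᵐ[gibbs β 0] fun p => zField p i * ∫ t in Set.Ioi (0 : ℝ),
        ∫ ω, (if pos ω t = j then F (localTime ω t) else 0) ∂(law β i (zField p)) := by
    filter_upwards [hocc] with p h
    rw [h.2]
  refine ⟨?_, ?_, ?_, ?_⟩
  · filter_upwards [hocc] with p h using h.1.prod_left_ae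
  · filter_upwards [hocc] with p h using h.1.integral_prod_right
  · refine Integrable.congr ?_ hval
    simp_rw [mul_sub]
    exact a3.sub b3
  · unfold expect
    rw [← integral_congr_ae hval]
    simp_rw [mul_sub]
    rw [integral_sub a3 b3, a4, b4, ← integral_sub a1 b1]
    refine integral_congr_ae (Filter.Eventually.of_forall fun p => ?_)
    simp only
    rw [← mul_sub]
    congr 1
    rcases le_total 0 (F (zField p)) with h | h <;> simp [h]
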